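/- Let $n\ge 0$ and let $\mathfrak M$ be a compact connected metric space which is an $n$-dimensional matchbox manifold: it carries a finite atlas of homeomorphisms $\varphi_i\colon \overline U_i\to[-1,1]^n\times\mathfrak T_i$ ($1\le i\le\nu$) with $\mathfrak T_i$ totally disconnected, such that the open sets $U_i=\varphi_i^{-1}((-1,1)^n\times\mathfrak T_i)$ cover $\mathfrak M$. The atlas is regular: the embedded transversals $\varphi_i^{-1}(\{0\}\times\mathfrak T_i)$ are pairwise disjoint, each closed plaque $\varphi_i^{-1}([-1,1]^n\times\{s\})$ meets at most one closed plaque of $\overline U_j$, and the intersection of two closed plaques is connected or empty. The leaves of $\mathfrak M$ are its path components. Let $\mathfrak T=\bigsqcup_i\mathfrak T_i$, with the metric $d_{\mathfrak T}$ which is induced from $\mathfrak M$ on each $\mathfrak T_i\cong\varphi_i^{-1}(\{0\}\times\mathfrak T_i)$ and is $\infty$ between different $\mathfrak T_i$. Let $h_{i,j}$ be the homeomorphism between open subsets of $\mathfrak T_i$ and $\mathfrak T_j$ which sends $s$ to $t$ when the (open) plaques of $s$ and $t$ meet, and let $\mathcal G^*$ be the holonomy pseudo$\star$group, consisting of all restrictions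 to open sets of compositions of the maps $h_{i,j}$ (without gluing). Assume that $\mathfrak M$ is equicontinuous, that is, for every $\varepsilon>0$ there is $\delta>0$ such that $d_{\mathfrak T}(\gamma y,\gamma z)<\varepsilon$ for all $\gamma\in\mathcal G^*$ and all $y,z$ in the domain of $\gamma$ with $d_{\mathfrak T}(y,z)<\delta$. Assume also that $\mathfrak M$ has finite $\pi_1$-type, that is, every leaf has finitely generated fundamental group. A section consists of a clopen set $V_0\subset\mathfrak T$, a group $G_0$ of homeomorphisms of $V_0$ such that the elements of $\mathcal G^*$ with domain and range in $V_0$ are exactly the restrictions of elements of $G_0$ to open subsets of $V_0$, a point $x\in V_0$, and clopen sets $V_0\supseteq V_1\supseteq\cdots$ with $\bigcap_\ell V_\ell=\{x\}$ such that for each $\ell$ the translates $gV_\ell$, $g\in G_0$, form a finite partition of $V_0$ into sets of $d_{\mathfrak T}$-diameter less than $2^{-\ell}$. Let $G_\ell=\{g\in G_0: gV_\ell=V_\ell\}$, acting on $V_\ell$ through $\Phi_\ell\colon G_\ell\to\mathrm{Homeo}(V_\ell)$, and let $\overline{\Phi_\ell(G_\ell)}$ be its closure in $\mathrm{Homeo}(V_\ell)$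 in the uniform topology (the Ellis group). The discriminant group $\mathcal D_x=\overline{\Phi_0(G_0)}_x$ is the isotropy group of $x$ in $\overline{\Phi_0(G_0)}$. A family of homeomorphisms between open sets is strongly quasi-analytic (SQA) if each of its members that is the identity on a non-empty open subset of its domain is the identity on its whole domain. Then: 1. There is a section $V_0$ for which the restriction of $\mathcal G^*$ to $V_0$, and equivalently the action $(V_0,G_0,\Phi_0)$, is SQA. 2. For every section whose discriminant group $\mathcal D_x$ is finite, there is an $n\ge0$ such that the action of $\Phi_n(G_n)$ on $V_n$ and the action of its closure $\overline{\Phi_n(G_n)}$ on $V_n$ are both SQA. -/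

import Mathlib

open Set Topology
open scoped ENNReal

universe u

noncomputable section

/-! ### Matchbox manifolds and their holonomy -/

/-- The closed cube `[-1,1]^n`. -/
abbrev Cube (n : ℕ) : Type := ↥(Set.Icc (-1 : Fin n → ℝ) 1)

/-- The open cube `(-1,1)^n`, as a subset of the closed cube. -/
def openCube (n : ℕ) : Set (Cube n) := {a | ∀ k, -1 < a.1 k ∧ a.1 k < 1}

/-- The centre `0` of the cube. -/
def cubeCenter (n : ℕ) : Cube n :=
  ⟨0, fun _ => by simp, fun _ => by simp⟩

/-- A finite regular foliated atlas with `n`-dimensional leaves and totally disconnected local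
transversals `T i`. The map `ψ i` is the inverse of the foliation chart
`φ i : closure (U i) ≃ₜ [-1,1]^n × T i`, with `U i` the image of `(-1,1)^n × T i`.
A compact connected metric space with such an atlas is an `n`-dimensional matchbox manifold. -/
structure RegularAtlas (n : ℕ) (M : Type u) [MetricSpace M] where
  /-- the number of charts -/
  ν : ℕ
  /-- the local transverse models -/
  T : Fin ν → Type u
  [topT : ∀ i, TopologicalSpace (T i)]
  [totDiscT : ∀ i, TotallyDisconnectedSpace (T i)]
  /-- the inverses of the foliation charts -/
  ψ : ∀ i, Cube n × T i → M
  isClosedEmbedding_ψ : ∀ i, IsClosedEmbedding (ψ i)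
  /-- the sets `U i` are open -/
  isOpen_image : ∀ i, IsOpen (ψ i '' (openCube n ×ˢ (univ : Set (T i))))
  /-- the sets `U i` cover `M` -/
  cover : ∀ p : M, ∃ i, p ∈ ψ i '' (openCube n ×ˢ (univ : Set (T i)))
  /-- the embedded transversals are pairwise disjoint -/
  disjoint_transversals : ∀ i j (s : T i) (t : T j),
    ψ i (cubeCenter n, s) = ψ j (cubeCenter n, t) → i = j
  /-- a closed plaque of one chart meets at most one closed plaque of another chart -/
  plaque_unique : ∀ i j (s : T i) (t t' : T j),
    (ψ i '' (univ ×ˢ {s}) ∩ ψ j '' (univ ×ˢ {t})).Nonempty →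
    (ψ i '' (univ ×ˢ {s}) ∩ ψ j '' (univ ×ˢ {t'})).Nonempty → t = t'
  /-- the intersection of two closed plaques is connected (or empty) -/
  plaque_inter_connected : ∀ i j (s : T i) (t : T j),
    IsPreconnected (ψ i '' (univ ×ˢ {s}) ∩ ψ j '' (univ ×ˢ {t}))

attribute [instance] RegularAtlas.topT RegularAtlas.totDiscT

namespace RegularAtlas

variable {n : ℕ} {M : Type u} [MetricSpace M] (A : RegularAtlas n M)

/-- The transverse space `𝔗 = T 1 ⊔ ⋯ ⊔ T ν`, with the disjoint union topology. -/
abbrev Transversal : Type u := Σ i : Fin A.ν, A.T i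

/-- The embedding of `𝔗` in `M`, which sends a point to the centre of its plaque. -/
def emb (y : A.Transversal) : M := A.ψ y.1 (cubeCenter n, y.2)

/-- The (open) plaque of `y ∈ 𝔗`. -/
def plaque (y : A.Transversal) : Set M := A.ψ y.1 '' (openCube n ×ˢ {y.2})

/-- The distance on `𝔗`: that of `M` inside one `T i`, and `∞` between different ones. -/
def transDist (y z : A.Transversal) : ℝ≥0∞ :=
  if y.1 = z.1 then edist (A.emb y) (A.emb z) else ⊤

/-- The diameter of a subset of `𝔗`. -/
def transDiam (S : Set A.Transversal) : ℝ≥0∞ := ⨆ y ∈ S, ⨆ z ∈ S, A.transDist y z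

/-- `A.chainRel [i₀, …, iₖ] y z` says that `z = h_{iₖ₋₁,iₖ} ∘ ⋯ ∘ h_{i₀,i₁} (y)`, where `h_{i,j}`
is the change of transverse coordinates from `T i` to `T j`: it sends `s ∈ T i` to the unique
`t ∈ T j` for which the plaque of `t` meets the plaque of `s`, if there is one.
For `[i]` it is the identity of `T i`. -/
def chainRel : List (Fin A.ν) → A.Transversal → A.Transversal → Prop
  | [], _, _ => False
  | [i], y, z => y.1 = i ∧ y = z
  | i :: j :: w, y, z => y.1 = i ∧
      ∃ y' : A.Transversal, (A.plaque y ∩ A.plaque y').Nonempty ∧ chainRel (j :: w) y' z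

/-- The holonomy pseudo-star-group: all restrictions to open sets of compositions of the maps
`h_{i,j}`, without gluing. -/
def pseudoStarGroup : Set (OpenPartialHomeomorph A.Transversal A.Transversal) :=
  {e | ∃ w : List (Fin A.ν), ∀ y ∈ e.source, A.chainRel w y (e y)}

/-- The elements of the holonomy pseudo-star-group with domain and range in `V`. -/
def pseudoStarGroupOn (V : Set A.Transversal) :
    Set (OpenPartialHomeomorph A.Transversal A.Transversal) :=
  {e | e ∈ A.pseudoStarGroup ∧ e.source ⊆ V ∧ e.target ⊆ V}

/-- Equicontinuity of the holonomy pseudo-star-group. -/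
def IsEquicontinuous : Prop :=
  ∀ ε : ℝ≥0∞, 0 < ε → ∃ δ : ℝ≥0∞, 0 < δ ∧ ∀ e ∈ A.pseudoStarGroup,
    ∀ y ∈ e.source, ∀ z ∈ e.source, A.transDist y z < δ → A.transDist (e y) (e z) < ε

end RegularAtlas

/-- Finite `π₁`-type of a path connected space. -/
def IsFinitePiOneType (X : Type u) [TopologicalSpace X] : Prop :=
  ∃ x : X, Group.FG (FundamentalGroup X x)

/-- All leaves, i.e. all path components of `M`, have finite `π₁`-type. As the local transversals
are totally disconnected, the topology induced from `M` and the leaf topology have the same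
paths and homotopies, hence the same fundamental group. -/
def LeavesFinitePiOneType (M : Type u) [TopologicalSpace M] : Prop :=
  ∀ p : M, IsFinitePiOneType (pathComponent p)

/-! ### Strong quasi-analyticity, Ellis groups, restricted actions -/

section Actions

variable {X : Type u} [TopologicalSpace X]

/-- Strong quasi-analyticity of a family of local homeomorphisms: a map in the family which is
the identity on a non-empty open subset of its domain is the identity on its domain. -/
def IsSQA (S : Set (OpenPartialHomeomorph X X)) : Prop :=
  ∀ h ∈ S, ∀ U : Set X, IsOpen U → U.Nonempty → U ⊆ h.source → (∀ y ∈ U, h y = y) →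
    ∀ y ∈ h.source, h y = y

/-- Strong quasi-analyticity of an action by homeomorphisms with domain the whole space. -/
def IsSQAAction (S : Set (X ≃ₜ X)) : Prop :=
  IsSQA ((fun g : X ≃ₜ X => g.toOpenPartialHomeomorph) '' S)

/-- The closure of a set of homeomorphisms in `Homeo(X)`, for the topology induced from the
compact-open topology on `C(X, X)`, which is the uniform topology when `X` is compact.
For a group of homeomorphisms this is the Ellis group of the action. -/
def ellisClosure (S : Set (X ≃ₜ X)) : Set (X ≃ₜ X) :=
  {f | (f : C(X, X)) ∈ closure ((fun g : X ≃ₜ X => (g : C(X, X))) '' S)}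

/-- The restriction to `W` of the stabilizer `{g ∈ G | g W = W}`. -/
def restrictedAction (G : Set (X ≃ₜ X)) (W : Set X) : Set (W ≃ₜ W) :=
  {f | ∃ g ∈ G, g '' W = W ∧ ∀ y : W, (f y : X) = g y}

end Actions

/-! ### Transverse sections -/

/-- A transverse section `V₀`, a group `G₀` of transformations of `V₀` generating the restriction
to `V₀` of the holonomy, a base point `x`, and a descending chain `V₀ = V 0 ⊇ V 1 ⊇ ⋯` of clopen
sets shrinking to `x`, such that the translates of each `V ℓ` form a finite partition of `V₀`
with pieces of diameter less than `2^(-ℓ)`. -/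
structure TransverseSection {n : ℕ} {M : Type u} [MetricSpace M] (A : RegularAtlas n M) where
  /-- the section -/
  V₀ : Set A.Transversal
  isClopen_V₀ : IsClopen V₀
  /-- the group of transformations of the section -/
  G₀ : Subgroup (V₀ ≃ₜ V₀)
  /-- the restriction to `V₀` of the holonomy pseudo-star-group consists exactly of the
  restrictions of the elements of `G₀` to open sets -/
  generates : ∀ e : OpenPartialHomeomorph A.Transversal A.Transversal,
    e ∈ A.pseudoStarGroupOn V₀ ↔
      e.source ⊆ V₀ ∧ ∃ g ∈ G₀, ∀ y : V₀, (y : A.Transversal) ∈ e.source →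
        e y = (g y : A.Transversal)
  /-- the base point -/
  x : V₀
  /-- the chain of clopen sets -/
  V : ℕ → Set V₀
  V_zero : V 0 = univ
  antitone_V : Antitone V
  isClopen_V : ∀ ℓ, IsClopen (V ℓ)
  iInter_V : ⋂ ℓ, V ℓ = {x}
  finite_translates : ∀ ℓ, {Q : Set V₀ | ∃ g ∈ G₀, Q = g '' V ℓ}.Finite
  isPartition_translates : ∀ ℓ, Setoid.IsPartition {Q : Set V₀ | ∃ g ∈ G₀, Q = g '' V ℓ}
  diam_translates : ∀ ℓ, ∀ g ∈ G₀,
    A.transDiam ((fun y : V₀ => (y : A.Transversal)) '' (g '' V ℓ)) < (2⁻¹ : ℝ≥0∞) ^ ℓ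

namespace TransverseSection

variable {n : ℕ} {M : Type u} [MetricSpace M] {A : RegularAtlas n M} (P : TransverseSection A)

/-- The action of `G₀` on `V₀`, as a set of homeomorphisms. -/
def action : Set (P.V₀ ≃ₜ P.V₀) := {g | g ∈ P.G₀}

/-- The discriminant group: the isotropy group at `x` of the Ellis group of `G₀`. -/
def discriminant : Set (P.V₀ ≃ₜ P.V₀) := {f | f ∈ ellisClosure P.action ∧ f P.x = P.x}

/-- The action on `V ℓ` of its stabilizer in `G₀`. -/
def actionOn (ℓ : ℕ) : Set (P.V ℓ ≃ₜ P.V ℓ) := restrictedAction P.action (P.V ℓ)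

end TransverseSection

end

/-! ### Plaques and the topology of the transversal -/

/-! Equicontinuity gives one modulus for all holonomy words, whatever their length. Replacing each
transition by a detour through a chart with a uniform margin therefore extends every word to a ball
of uniform radius (`IsEquicontinuous.exists_extension`). Coding points by their itineraries through
a fine clopen partition then yields arbitrarily fine holonomy-invariant clopen partitions
(`IsEquicontinuous.exists_invariantRel`). With connectedness of `M` this gives minimality, and small
classes become transverse sections whose group consists of single words.

For the first assertion, Baire category gives a point `x` at which every isotropy word has trivial
germ (`exists_trivial_germs`). The neighbourhoods of triviality must be made independent of the
word. The classes of an invariant partition are the fibres of a covering of `M` whose monodromy is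
holonomy: words give paths (`exists_path_of_chainRel`) and loops give words (`exists_word_of_loop`).
Finitely many loops generate the fundamental group of the leaf, so a neighbourhood that serves the
generators serves all words (`exists_trivial_isotropy`). By minimality, an element that is trivial
on some open set is conjugate to one fixing `x`, hence is trivial on the section
(`exists_sqa_section`).

For the second assertion, finiteness of the discriminant group provides one level `l` such that each
of its elements with trivial germ at `x` is the identity on `V l`. An element of the closure on `V
l` that is trivial on an open set is conjugated so that this set contains `x`. A compactness
argument (`InvariantFiltration.exists_limit`) extends the conjugate to an element of the
discriminant group, so it is trivial on `V l`. -/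

theorem EMetricSpace.to_t2Space (X : Type*) [EMetricSpace X] : T2Space X := inferInstance

/-! ### Contraction of the cube to its centre -/

section Cubes

variable {n : ℕ}

/-- Scaling of the closed cube towards its centre. -/
def cubeScale (r : unitInterval) (a : Cube n) : Cube n :=
  ⟨fun k => r * a.1 k, fun k => by
    have h1 := a.2.1 k; have h2 := a.2.2 k; have h3 := r.2.1; have h4 := r.2.2
    simp only [Pi.neg_apply, Pi.one_apply] at *
    nlinarith, fun k => by
    have h1 := a.2.1 k; have h2 := a.2.2 k; have h3 := r.2.1; have h4 := r.2.2
    simp only [Pi.neg_apply, Pi.one_apply] at *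
    nlinarith⟩

theorem continuous_cubeScale :
    Continuous (fun q : unitInterval × Cube n => cubeScale q.1 q.2) := by
  unfold cubeScale
  refine Continuous.subtype_mk (continuous_pi fun k => ?_) _
  have : Continuous fun q : unitInterval × Cube n => q.2.1 k :=
    (continuous_apply k).comp (continuous_subtype_val.comp continuous_snd)
  fun_prop

theorem cubeScale_one (a : Cube n) : cubeScale 1 a = a := by
  apply Subtype.ext; funext k; simp [cubeScale]

theorem cubeScale_zero (a : Cube n) : cubeScale 0 a = cubeCenter n := by
  apply Subtype.ext; funext k; simp [cubeScale, cubeCenter]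

theorem cubeScale_mem {r : unitInterval} (hr : r < 1) (a : Cube n) :
    cubeScale r a ∈ openCube n := by
  intro k
  have h1 := a.2.1 k; have h2 := a.2.2 k; have h3 := r.2.1
  have h4 : (r : ℝ) < 1 := hr
  simp only [Pi.neg_apply, Pi.one_apply, cubeScale] at *
  constructor <;> nlinarith

theorem cubeCenter_mem : cubeCenter n ∈ openCube n := by
  intro k; simp [cubeCenter]

end Cubes

namespace RegularAtlas

variable {n : ℕ} {M : Type u} [MetricSpace M] (A : RegularAtlas n M)

/-- All inverse foliation charts, as one map. -/
def param (q : Cube n × A.Transversal) : M := A.ψ q.2.1 (q.1, q.2.2)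

/-- The closed plaque of `y`. -/
def closedPlaque (y : A.Transversal) : Set M := A.ψ y.1 '' (univ ×ˢ {y.2})

/-- The open domain of the `i`-th chart. -/
def chartDomain (i : Fin A.ν) : Set M := A.ψ i '' (openCube n ×ˢ (univ : Set (A.T i)))

/-- The open plaques of two points of the transversal meet. -/
def Meets (y z : A.Transversal) : Prop := (A.plaque y ∩ A.plaque z).Nonempty

/-- The closed plaques of two points of the transversal meet. -/
def ClosedMeets (y z : A.Transversal) : Prop := (A.closedPlaque y ∩ A.closedPlaque z).Nonempty

theorem continuous_param : Continuous A.param := by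
  have h : A.param = (fun q : Σ i, A.T i × Cube n => A.ψ q.1 (q.2.2, q.2.1)) ∘
      Homeomorph.sigmaProdDistrib ∘ Prod.swap := by
    funext ⟨a, i, s⟩; rfl
  rw [h]
  refine Continuous.comp (continuous_sigma fun i => ?_)
    (Homeomorph.sigmaProdDistrib.continuous.comp continuous_swap)
  exact (A.isClosedEmbedding_ψ i).continuous.comp continuous_swap

theorem mem_plaque {p : M} {y : A.Transversal} :
    p ∈ A.plaque y ↔ ∃ a ∈ openCube n, A.param (a, y) = p := by
  constructor
  · rintro ⟨⟨a, s⟩, ⟨ha, hs⟩, rfl⟩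
    exact ⟨a, ha, by rw [show s = y.2 from hs]; rfl⟩
  · rintro ⟨a, ha, rfl⟩
    exact ⟨(a, y.2), ⟨ha, rfl⟩, rfl⟩

theorem mem_closedPlaque {p : M} {y : A.Transversal} :
    p ∈ A.closedPlaque y ↔ ∃ a, A.param (a, y) = p := by
  constructor
  · rintro ⟨⟨a, s⟩, ⟨ha, hs⟩, rfl⟩
    exact ⟨a, by rw [show s = y.2 from hs]; rfl⟩
  · rintro ⟨a, rfl⟩
    exact ⟨(a, y.2), ⟨mem_univ _, rfl⟩, rfl⟩

theorem mem_chartDomain {p : M} {i : Fin A.ν} :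
    p ∈ A.chartDomain i ↔ ∃ y : A.Transversal, y.1 = i ∧ p ∈ A.plaque y := by
  constructor
  · rintro ⟨⟨a, s⟩, ⟨ha, hs⟩, rfl⟩
    exact ⟨⟨i, s⟩, rfl, A.mem_plaque.2 ⟨a, ha, rfl⟩⟩
  · rintro ⟨y, rfl, hp⟩
    obtain ⟨a, ha, rfl⟩ := A.mem_plaque.1 hp
    exact ⟨(a, y.2), ⟨ha, mem_univ _⟩, rfl⟩

theorem isOpen_chartDomain (i : Fin A.ν) : IsOpen (A.chartDomain i) := A.isOpen_image i

theorem param_mem_plaque {a : Cube n} (ha : a ∈ openCube n) (y : A.Transversal) :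
    A.param (a, y) ∈ A.plaque y := A.mem_plaque.2 ⟨a, ha, rfl⟩

theorem param_mem_closedPlaque (a : Cube n) (y : A.Transversal) :
    A.param (a, y) ∈ A.closedPlaque y := A.mem_closedPlaque.2 ⟨a, rfl⟩

theorem emb_eq (y : A.Transversal) : A.emb y = A.param (cubeCenter n, y) := rfl

theorem emb_mem_plaque (y : A.Transversal) : A.emb y ∈ A.plaque y :=
  A.param_mem_plaque cubeCenter_mem y

theorem plaque_subset (y : A.Transversal) : A.plaque y ⊆ A.closedPlaque y := by
  intro p hp
  obtain ⟨a, -, rfl⟩ := A.mem_plaque.1 hp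
  exact A.param_mem_closedPlaque a y

theorem plaque_subset_chartDomain (y : A.Transversal) : A.plaque y ⊆ A.chartDomain y.1 :=
  fun _ hp => A.mem_chartDomain.2 ⟨y, rfl, hp⟩

variable {A}

theorem Meets.symm {y z : A.Transversal} (h : A.Meets y z) : A.Meets z y := by
  rwa [Meets, inter_comm]

theorem Meets.closed {y z : A.Transversal} (h : A.Meets y z) : A.ClosedMeets y z :=
  h.mono (inter_subset_inter (A.plaque_subset y) (A.plaque_subset z))

theorem ClosedMeets.unique {y z z' : A.Transversal} (h : A.ClosedMeets y z)
    (h' : A.ClosedMeets y z') (hi : z.1 = z'.1) : z = z' := by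
  rcases z with ⟨j, t⟩
  rcases z' with ⟨j', t'⟩
  obtain rfl : j = j' := hi
  have := A.plaque_unique y.1 j y.2 t t' h h'
  rw [this]

theorem eq_of_mem_closedPlaque {p : M} {y z : A.Transversal} (hy : p ∈ A.closedPlaque y)
    (hz : p ∈ A.closedPlaque z) (hi : y.1 = z.1) : y = z :=
  ClosedMeets.unique (y := y) ⟨p, hy, hy⟩ ⟨p, hy, hz⟩ hi

theorem meets_self (y : A.Transversal) : A.Meets y y :=
  ⟨A.emb y, A.emb_mem_plaque y, A.emb_mem_plaque y⟩

/-- Scaling towards the centre moves a point of the closed plaque into the open one by an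
arbitrarily small amount. Open conditions on `M` can thus be tested on open plaques. -/
theorem exists_param_mem {q : M} {y : A.Transversal} (hy : q ∈ A.closedPlaque y) {W : Set M}
    (hW : IsOpen W) (hq : q ∈ W) : ∃ a ∈ openCube n, A.param (a, y) ∈ W := by
  obtain ⟨a, rfl⟩ := A.mem_closedPlaque.1 hy
  have hc : Continuous fun r : unitInterval => A.param (cubeScale r a, y) :=
    A.continuous_param.comp ((continuous_cubeScale.comp
      (continuous_id.prodMk continuous_const)).prodMk continuous_const)
  have h1 : ∀ᶠ r in 𝓝 (1 : unitInterval), A.param (cubeScale r a, y) ∈ W := by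
    refine hc.continuousAt.eventually_mem (hW.mem_nhds ?_)
    simpa [cubeScale_one] using hq
  have h2 : (𝓝[<] (1 : unitInterval)).NeBot :=
    nhdsLT_neBot_of_exists_lt ⟨0, by exact zero_lt_one⟩
  obtain ⟨r, hr, hr1⟩ := ((h1.filter_mono nhdsWithin_le_nhds).and
    (self_mem_nhdsWithin : Iio (1 : unitInterval) ∈ 𝓝[<] 1)).exists
  exact ⟨_, cubeScale_mem hr1 a, hr⟩

/-- A closed plaque which meets an open plaque meets it in a point of its interior. -/
theorem meets_of_mem {q : M} {y u : A.Transversal} (hy : q ∈ A.closedPlaque y)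
    (hu : q ∈ A.plaque u) : A.Meets y u := by
  obtain ⟨a, ha, h⟩ := exists_param_mem hy (A.isOpen_chartDomain u.1)
    (A.plaque_subset_chartDomain u hu)
  -- The perturbed point lies on some plaque of the chart of `u`; since the closed plaque of `y`
  -- meets only one of these, it is the plaque of `u`.
  obtain ⟨u', hi, hu'⟩ := A.mem_chartDomain.1 h
  have e : u' = u := ClosedMeets.unique (y := y)
    ⟨_, A.param_mem_closedPlaque _ y, A.plaque_subset _ hu'⟩
    ⟨_, hy, A.plaque_subset _ hu⟩ hi
  exact ⟨_, A.param_mem_plaque ha y, e ▸ hu'⟩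

variable (A)

theorem emb_injective : Function.Injective A.emb := by
  intro y z h
  have hi : y.1 = z.1 := A.disjoint_transversals y.1 z.1 y.2 z.2 h
  exact eq_of_mem_closedPlaque (p := A.emb y) (A.plaque_subset _ (A.emb_mem_plaque y))
    (h ▸ A.plaque_subset _ (A.emb_mem_plaque z)) hi

theorem continuous_emb : Continuous A.emb :=
  A.continuous_param.comp (continuous_const.prodMk continuous_id)

instance t2Space_transversal : T2Space A.Transversal :=
  .of_injective_continuous A.emb_injective A.continuous_emb

section Compact

variable [CompactSpace M]

instance compactSpace_T (i : Fin A.ν) : CompactSpace (A.T i) := by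
  have : CompactSpace (Cube n × A.T i) := (A.isClosedEmbedding_ψ i).compactSpace
  have : Nonempty (Cube n) := ⟨cubeCenter n⟩
  exact ⟨by
    rw [← (Prod.snd_surjective (α := Cube n) (β := A.T i)).range_eq]
    exact isCompact_range continuous_snd⟩

theorem isClosed_closedPlaque : IsClosed {q : M × A.Transversal | q.1 ∈ A.closedPlaque q.2} := by
  have : {q : M × A.Transversal | q.1 ∈ A.closedPlaque q.2} =
      range (fun r : Cube n × A.Transversal => (A.param r, r.2)) := by
    ext ⟨p, y⟩
    simp [mem_closedPlaque, Prod.ext_iff]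
  rw [this]
  exact (isCompact_range (A.continuous_param.prodMk continuous_snd)).isClosed

theorem isClosed_closedMeets :
    IsClosed {q : A.Transversal × A.Transversal | A.ClosedMeets q.1 q.2} := by
  have h : IsClosed {q : (A.Transversal × A.Transversal) × M |
      q.2 ∈ A.closedPlaque q.1.1 ∧ q.2 ∈ A.closedPlaque q.1.2} :=
    (A.isClosed_closedPlaque.preimage
      (f := fun q : (A.Transversal × A.Transversal) × M => (q.2, q.1.1)) (by fun_prop)).inter
    (A.isClosed_closedPlaque.preimage
      (f := fun q : (A.Transversal × A.Transversal) × M => (q.2, q.1.2)) (by fun_prop))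
  have := isClosedMap_fst_of_compactSpace _ h
  convert this using 1
  ext ⟨y, z⟩
  simp only [ClosedMeets, Set.Nonempty, mem_inter_iff, mem_ofPred_eq, mem_image, Prod.exists,
    exists_and_right, exists_eq_right]

end Compact

variable {A}

theorem eventually_index (y : A.Transversal) : ∀ᶠ z in 𝓝 y, z.1 = y.1 := by
  have : IsOpen {z : A.Transversal | z.1 = y.1} := by
    have h : {z : A.Transversal | z.1 = y.1} = range (Sigma.mk y.1) := by
      ext ⟨i, s⟩
      constructor
      · intro h; obtain rfl : i = y.1 := h; exact ⟨s, rfl⟩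
      · rintro ⟨t, ht⟩; exact (congrArg Sigma.fst ht).symm
    rw [h]; exact isOpen_range_sigmaMk
  exact this.mem_nhds rfl

theorem isClosed_index (i : Fin A.ν) : IsClosed {z : A.Transversal | z.1 = i} := by
  rw [← isOpen_compl_iff, isOpen_iff_mem_nhds]
  intro y hy
  filter_upwards [eventually_index y] with z hz h
  exact hy (hz.symm.trans h)

section Compact

variable [CompactSpace M]

/-- The change of transverse coordinates is continuous, even when extended to closed plaques. -/
theorem ClosedMeets.eventually {y u : A.Transversal} (h : A.ClosedMeets y u)
    {W : Set A.Transversal} (hW : W ∈ 𝓝 u) :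
    ∀ᶠ y' in 𝓝 y, ∀ u' : A.Transversal, u'.1 = u.1 → A.ClosedMeets y' u' → u' ∈ W := by
  -- The points with a partner outside the interior of `W` form the projection of a closed set along
  -- a compact factor. By uniqueness of the partner `u`, the point `y` is not among them.
  have hcl : IsClosed {q : A.Transversal × A.Transversal |
      A.ClosedMeets q.1 q.2 ∧ q.2.1 = u.1 ∧ q.2 ∈ (interior W)ᶜ} :=
    A.isClosed_closedMeets.inter (((isClosed_index u.1).preimage continuous_snd).inter
      (isOpen_interior.isClosed_compl.preimage continuous_snd))
  have h2 := isClosedMap_fst_of_compactSpace _ hcl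
  filter_upwards [h2.isOpen_compl.mem_nhds (x := y) (by
    rintro ⟨⟨y', u'⟩, ⟨h1, h2, h3⟩, rfl⟩
    exact h3 (mem_interior_iff_mem_nhds.2 ((h.unique h1 h2.symm) ▸ hW)))] with y' hy' u' hi hu'
  by_contra hc
  exact hy' ⟨(y', u'), ⟨hu', hi, fun hh => hc (interior_subset hh)⟩, rfl⟩

end Compact

/-- The domain of a change of transverse coordinates is open. -/
theorem Meets.eventually {y u : A.Transversal} (h : A.Meets y u) :
    ∀ᶠ y' in 𝓝 y, ∃ u' : A.Transversal, u'.1 = u.1 ∧ A.Meets y' u' := by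
  obtain ⟨p, hp, hpu⟩ := h
  obtain ⟨a, ha, rfl⟩ := A.mem_plaque.1 hp
  have hc : Continuous fun y' => A.param (a, y') :=
    A.continuous_param.comp (continuous_const.prodMk continuous_id)
  filter_upwards [hc.continuousAt.eventually_mem ((A.isOpen_chartDomain u.1).mem_nhds
    (A.plaque_subset_chartDomain u hpu))] with y' hy'
  obtain ⟨u', hi, hu'⟩ := A.mem_chartDomain.1 hy'
  exact ⟨u', hi, _, A.param_mem_plaque ha y', hu'⟩

/-! ### The metric of the transversal -/

variable (A)

theorem transDist_self (y : A.Transversal) : A.transDist y y = 0 := by simp [transDist]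

theorem transDist_comm (y z : A.Transversal) : A.transDist y z = A.transDist z y := by
  simp [transDist, eq_comm, edist_comm]

theorem transDist_triangle (x y z : A.Transversal) :
    A.transDist x z ≤ A.transDist x y + A.transDist y z := by
  unfold transDist
  by_cases h1 : x.1 = y.1 <;> by_cases h2 : y.1 = z.1
  · rw [if_pos h1, if_pos h2, if_pos (h1.trans h2)]
    exact edist_triangle _ _ _
  · simp [h2]
  · simp [h1]
  · simp [h1]

theorem eq_of_transDist {y z : A.Transversal} (h : A.transDist y z = 0) : y = z := by
  unfold transDist at h
  split_ifs at h with hi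
  · exact A.emb_injective (edist_eq_zero.1 h)
  · exact absurd h ENNReal.top_ne_zero

variable {A}

theorem index_eq_of_transDist_lt {y z : A.Transversal} {δ : ℝ≥0∞} (h : A.transDist y z < δ) :
    y.1 = z.1 := by
  unfold transDist at h
  split_ifs at h with hi
  · exact hi
  · exact absurd h (not_lt.2 le_top)

variable (A)

theorem eventually_transDist_lt (y : A.Transversal) {δ : ℝ≥0∞} (hδ : 0 < δ) :
    ∀ᶠ z in 𝓝 y, A.transDist y z < δ := by
  filter_upwards [eventually_index y, A.continuous_emb.continuousAt.eventually_mem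
    (Metric.eball_mem_nhds (A.emb y) hδ)] with z h1 h2
  rw [transDist, if_pos h1.symm, edist_comm]
  exact h2

variable [CompactSpace M]

/-- The distance of the transversal as a metric structure. -/
noncomputable abbrev transEMetricCore : EMetricSpace A.Transversal where
  edist := A.transDist
  edist_self := A.transDist_self
  edist_comm := A.transDist_comm
  edist_triangle := A.transDist_triangle
  eq_of_edist_eq_zero := A.eq_of_transDist

/-- The identity is a continuous bijection from a compact space to a Hausdorff space, hence closed.
-/
theorem topology_eq_transEMetricCore :
    (inferInstance : TopologicalSpace A.Transversal) =
      A.transEMetricCore.toUniformSpace.toTopologicalSpace := by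
  have hc : @Continuous _ _ _ A.transEMetricCore.toUniformSpace.toTopologicalSpace
      (id : A.Transversal → _) := by
    refine @continuous_iff_continuousAt _ _ _ (_) _ |>.2 fun y => ?_
    refine (@EMetric.tendsto_nhds _ _ A.transEMetricCore.toPseudoEMetricSpace _ _ _).2 ?_
    intro δ hδ
    filter_upwards [A.eventually_transDist_lt y hδ] with z hz
    change A.transDist z y < δ
    rwa [transDist_comm]
  apply le_antisymm
  · exact continuous_id_iff_le.1 hc
  · have h2 : @T2Space A.Transversal A.transEMetricCore.toUniformSpace.toTopologicalSpace :=
      @EMetricSpace.to_t2Space _ A.transEMetricCore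
    have := @Continuous.isClosedMap _ _ _ A.transEMetricCore.toUniformSpace.toTopologicalSpace
      _ _ _ hc
    intro U hU
    have h3 := this Uᶜ (IsOpen.isClosed_compl hU)
    rw [image_id] at h3
    exact (@isClosed_compl_iff _ A.transEMetricCore.toUniformSpace.toTopologicalSpace _).1 h3

/-- The metric structure of the transversal, with its original topology. -/
noncomputable abbrev transEMetric : EMetricSpace A.Transversal :=
  A.transEMetricCore.replaceTopology A.topology_eq_transEMetricCore

theorem exists_transDist_ball {y : A.Transversal} {W : Set A.Transversal} (hW : W ∈ 𝓝 y) :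
    ∃ δ : ℝ≥0∞, 0 < δ ∧ ∀ z, A.transDist y z < δ → z ∈ W := by
  let := A.transEMetric
  obtain ⟨δ, hδ, h⟩ := EMetric.mem_nhds_iff.1 hW
  refine ⟨δ, hδ, fun z hz => h ?_⟩
  rw [transDist_comm] at hz
  exact hz

theorem exists_lebesgue_number {c : A.Transversal → Set A.Transversal} (hc : ∀ y, c y ∈ 𝓝 y) :
    ∃ δ : ℝ≥0∞, 0 < δ ∧ ∀ x, ∃ y, ∀ z, A.transDist x z < δ → z ∈ c y := by
  let := A.transEMetric
  obtain ⟨δ, hδ, h⟩ := lebesgue_number_lemma_of_emetric_nhds (isCompact_univ)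
    (fun y _ => hc y)
  refine ⟨δ, hδ, fun x => (h x (mem_univ _)).imp fun y hy z hz => hy ?_⟩
  rw [transDist_comm] at hz
  exact hz

/-- Uniform continuity along a compact family of plaques. -/
theorem exists_param_close {ε : ℝ} (hε : 0 < ε) :
    ∃ δ : ℝ≥0∞, 0 < δ ∧ ∀ (a : Cube n) (y y' : A.Transversal), A.transDist y y' < δ →
      dist (A.param (a, y)) (A.param (a, y')) < ε := by
  let := A.transEMetric
  have hu : UniformContinuous A.param :=
    CompactSpace.uniformContinuous_of_continuous A.continuous_param
  rw [EMetric.uniformContinuous_iff] at hu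
  obtain ⟨δ, hδ, h⟩ := hu (ENNReal.ofReal ε) (by simpa using hε)
  refine ⟨δ, hδ, fun a y y' hy => ?_⟩
  have := h (a := (a, y)) (b := (a, y')) (by
    rw [Prod.edist_eq, edist_self]
    exact max_lt hδ hy)
  rwa [edist_dist, ENNReal.ofReal_lt_ofReal_iff hε] at this

end RegularAtlas

namespace RegularAtlas

variable {n : ℕ} {M : Type u} [MetricSpace M] {A : RegularAtlas n M}

/-! ### Words in the changes of transverse coordinates -/

theorem chainRel_head {i : Fin A.ν} {w : List (Fin A.ν)} {y z : A.Transversal}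
    (h : A.chainRel (i :: w) y z) : y.1 = i := by
  cases w with
  | nil => exact h.1
  | cons j w => exact h.1

theorem chainRel_refl (y : A.Transversal) : A.chainRel [y.1] y y := ⟨rfl, rfl⟩

theorem chainRel_unique : ∀ {w : List (Fin A.ν)} {y z z' : A.Transversal},
    A.chainRel w y z → A.chainRel w y z' → z = z'
  | [], _, _, _, h, _ => h.elim
  | [_], _, _, _, h, h' => h.2.symm.trans h'.2
  | i :: j :: w, y, z, z', ⟨_, y1, h1, h2⟩, ⟨_, y1', h1', h2'⟩ => by
    have e : y1 = y1' :=
      (show A.Meets y y1 from h1).closed.unique (show A.Meets y y1' from h1').closed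
      ((chainRel_head h2).trans (chainRel_head h2').symm)
    subst e
    exact chainRel_unique h2 h2'

/-- The letter `k` is dropped because it is already the last letter of `w`. -/
theorem chainRel_comp : ∀ {w w' : List (Fin A.ν)} {k : Fin A.ν} {y z t : A.Transversal},
    A.chainRel w y z → A.chainRel (k :: w') z t → A.chainRel (w ++ w') y t
  | [], _, _, _, _, _, h, _ => h.elim
  | [i], w', k, y, z, t, h, h' => by
    obtain rfl := h.2
    have : k = i := (chainRel_head h').symm.trans h.1
    subst this
    exact h'
  | i :: j :: w, w', k, y, z, t, ⟨h0, y1, h1, h2⟩, h' =>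
    ⟨h0, y1, h1, chainRel_comp h2 h'⟩

theorem chainRel_snoc {w : List (Fin A.ν)} {y z t : A.Transversal}
    (h : A.chainRel w y z) (h' : A.Meets z t) : A.chainRel (w ++ [t.1]) y t :=
  chainRel_comp h (k := z.1) (w' := [t.1]) ⟨rfl, t, h', rfl, rfl⟩

theorem chainRel_reverse : ∀ {w : List (Fin A.ν)} {y z : A.Transversal},
    A.chainRel w y z → A.chainRel w.reverse z y
  | [], _, _, h => h.elim
  | [_], _, _, h => by obtain ⟨rfl, rfl⟩ := h; exact ⟨rfl, rfl⟩
  | i :: j :: w, y, z, ⟨h0, y1, h1, h2⟩ => by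
    have := chainRel_snoc (chainRel_reverse h2) (Meets.symm h1)
    rw [h0] at this
    rw [List.reverse_cons]
    exact this

theorem chainRel_reverse_iff {w : List (Fin A.ν)} {y z : A.Transversal} :
    A.chainRel w.reverse z y ↔ A.chainRel w y z :=
  ⟨fun h => by simpa using chainRel_reverse h, chainRel_reverse⟩

theorem chainRel_injective {w : List (Fin A.ν)} {y y' z : A.Transversal}
    (h : A.chainRel w y z) (h' : A.chainRel w y' z) : y = y' :=
  chainRel_unique (chainRel_reverse h) (chainRel_reverse h')

variable [CompactSpace M]

theorem chainRel_eventually : ∀ {w : List (Fin A.ν)} {y z : A.Transversal},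
    A.chainRel w y z → ∀ {W : Set A.Transversal}, W ∈ 𝓝 z →
      ∀ᶠ y' in 𝓝 y, ∃ z' ∈ W, A.chainRel w y' z'
  | [], _, _, h, _, _ => h.elim
  | [i], y, z, h, W, hW => by
    obtain ⟨rfl, rfl⟩ := h
    filter_upwards [hW, eventually_index y] with y' h1 h2
    exact ⟨y', h1, h2, rfl⟩
  | i :: j :: w, y, z, ⟨h0, y1, h1, h2⟩, W, hW => by
    have h1 : A.Meets y y1 := h1
    filter_upwards [h1.eventually, h1.closed.eventually (chainRel_eventually h2 hW),
      eventually_index y] with y' ⟨u, hu, hm⟩ h4 h5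
    obtain ⟨z', hz', hc⟩ := h4 u hu hm.closed
    exact ⟨z', hz', h5.trans h0, u, hm, hc⟩

theorem isOpen_chainRel_dom (w : List (Fin A.ν)) :
    IsOpen {y : A.Transversal | ∃ z, A.chainRel w y z} := by
  rw [isOpen_iff_mem_nhds]
  rintro y ⟨z, hz⟩
  filter_upwards [chainRel_eventually hz Filter.univ_mem] with y' ⟨z', _, h⟩
  exact ⟨z', h⟩

open Classical in
/-- The composition of the changes of transverse coordinates along a word, as a function. -/
noncomputable def wordFun (w : List (Fin A.ν)) (y : A.Transversal) : A.Transversal :=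
  if h : ∃ z, A.chainRel w y z then h.choose else y

omit [CompactSpace M] in
theorem chainRel_wordFun {w : List (Fin A.ν)} {y : A.Transversal} (h : ∃ z, A.chainRel w y z) :
    A.chainRel w y (wordFun w y) := by
  rw [wordFun, dif_pos h]; exact h.choose_spec

omit [CompactSpace M] in
theorem wordFun_eq {w : List (Fin A.ν)} {y z : A.Transversal} (h : A.chainRel w y z) :
    wordFun w y = z := chainRel_unique (chainRel_wordFun ⟨z, h⟩) h

theorem continuousAt_wordFun {w : List (Fin A.ν)} {y : A.Transversal}
    (h : ∃ z, A.chainRel w y z) : ContinuousAt (wordFun w) y := by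
  intro W hW
  change ∀ᶠ y' in 𝓝 y, wordFun w y' ∈ W
  filter_upwards [chainRel_eventually (chainRel_wordFun h) hW] with y' ⟨z', h1, h2⟩
  rw [wordFun_eq h2]
  exact h1

/-- The composition of the changes of transverse coordinates along a word. -/
noncomputable def wordHomeo (w : List (Fin A.ν)) :
    OpenPartialHomeomorph A.Transversal A.Transversal where
  toFun := wordFun w
  invFun := wordFun w.reverse
  source := {y | ∃ z, A.chainRel w y z}
  target := {z | ∃ y, A.chainRel w y z}
  map_source' y hy := ⟨y, chainRel_wordFun hy⟩
  map_target' z := by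
    rintro ⟨y, hy⟩
    rw [wordFun_eq (chainRel_reverse hy)]
    exact ⟨z, hy⟩
  left_inv' y hy := wordFun_eq (chainRel_reverse (chainRel_wordFun hy))
  right_inv' z := by
    rintro ⟨y, hy⟩
    rw [wordFun_eq (chainRel_reverse hy), wordFun_eq hy]
  open_source := isOpen_chainRel_dom w
  open_target := by simpa only [chainRel_reverse_iff] using isOpen_chainRel_dom w.reverse
  continuousOn_toFun y hy := (continuousAt_wordFun hy).continuousWithinAt
  continuousOn_invFun z := by
    rintro ⟨y, hy⟩
    exact (continuousAt_wordFun ⟨y, chainRel_reverse hy⟩).continuousWithinAt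

/-- One `δ` serves words of every length; all later uniformity rests on this. -/
theorem IsEquicontinuous.chainRel (h : A.IsEquicontinuous) {ε : ℝ≥0∞} (hε : 0 < ε) :
    ∃ δ : ℝ≥0∞, 0 < δ ∧ ∀ (w : List (Fin A.ν)) (y z y' z' : A.Transversal),
      A.chainRel w y y' → A.chainRel w z z' → A.transDist y z < δ → A.transDist y' z' < ε := by
  obtain ⟨δ, hδ, H⟩ := h ε hε
  refine ⟨δ, hδ, fun w y z y' z' hy hz hd => ?_⟩
  have := H (wordHomeo w) ⟨w, fun y hy => chainRel_wordFun hy⟩ y ⟨y', hy⟩ z ⟨z', hz⟩ hd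
  change A.transDist (wordFun w y) (wordFun w z) < ε at this
  rwa [wordFun_eq hy, wordFun_eq hz] at this

/-! ### A cover by points which lie well inside of a chart -/

/-- The plaques of one chart, scaled by `r < 1`, fill a compact subset of its open domain. -/
theorem exists_ball_subset_chartDomain (A : RegularAtlas n M) {r : unitInterval} (hr : r < 1) :
    ∃ l : ℝ, 0 < l ∧ ∀ (a : Cube n) (y : A.Transversal),
      Metric.ball (A.param (cubeScale r a, y)) l ⊆ A.chartDomain y.1 := by
  have h : ∀ i : Fin A.ν, ∀ᶠ l : ℝ in 𝓝[>] 0, ∀ (a : Cube n) (y : A.Transversal), y.1 = i →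
      Metric.ball (A.param (cubeScale r a, y)) l ⊆ A.chartDomain i := by
    intro i
    have hc : Continuous fun q : Cube n × A.Transversal => A.param (cubeScale r q.1, q.2) :=
      A.continuous_param.comp ((continuous_cubeScale.comp
        (continuous_const.prodMk continuous_fst)).prodMk continuous_snd)
    have hK : IsCompact ((fun q : Cube n × A.Transversal => A.param (cubeScale r q.1, q.2)) ''
        {q | q.2.1 = i}) :=
      ((isClosed_index i).preimage continuous_snd).isCompact.image hc
    obtain ⟨l, hl, hs⟩ := hK.exists_thickening_subset_open (A.isOpen_chartDomain i) (by
      rintro _ ⟨⟨a, y⟩, rfl, rfl⟩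
      exact A.plaque_subset_chartDomain y (A.param_mem_plaque (cubeScale_mem hr a) y))
    filter_upwards [Ioo_mem_nhdsGT hl] with l' hl' a y hi
    refine Subset.trans (Metric.ball_subset_ball hl'.2.le) (Subset.trans ?_ hs)
    exact Metric.ball_subset_thickening (mem_image_of_mem (fun q : Cube n × A.Transversal =>
      A.param (cubeScale r q.1, q.2)) (show (a, y) ∈ {q | q.2.1 = i} from hi)) _
  obtain ⟨l, hl, h0⟩ := ((Filter.eventually_all.2 h).and self_mem_nhdsWithin).exists
  exact ⟨l, h0, fun a y => hl y.1 a y rfl⟩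

/-- An open cover of `M` which refines the cover by the domains of the charts, with a margin. -/
structure GoodCover (A : RegularAtlas n M) where
  /-- the open sets -/
  O : Fin A.ν → Set M
  isOpen_O : ∀ k, IsOpen (O k)
  cover : ∀ p, ∃ k, p ∈ O k
  emb_mem : ∀ y : A.Transversal, A.emb y ∈ O y.1
  /-- the margin -/
  r : ℝ
  r_pos : 0 < r
  ball_subset : ∀ k, ∀ b ∈ O k, Metric.ball b r ⊆ A.chartDomain k

theorem exists_goodCover (A : RegularAtlas n M) : Nonempty (GoodCover A) := by
  obtain ⟨l, hl, h1⟩ := A.exists_ball_subset_chartDomain (r := 0) zero_lt_one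
  obtain ⟨l', hl', h2⟩ := lebesgue_number_lemma_of_metric (isCompact_univ (X := M))
    A.isOpen_chartDomain (fun p _ => mem_iUnion.2 (A.cover p))
  -- `O k` is the union of the `r`-balls about the points whose `2 * r`-balls lie in the chart
  -- domain; the radius given away is the margin.
  set r := min l l' / 2 with hr
  have hrp : 0 < r := by positivity
  have hrl : 2 * r ≤ l := by rw [hr]; linarith [min_le_left l l']
  have hrl' : 2 * r ≤ l' := by rw [hr]; linarith [min_le_right l l']
  refine ⟨⟨fun k => ⋃ p ∈ {p | Metric.ball p (2 * r) ⊆ A.chartDomain k}, Metric.ball p r,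
    fun k => isOpen_biUnion fun _ _ => Metric.isOpen_ball, fun p => ?_, fun y => ?_, r, hrp, ?_⟩⟩
  · obtain ⟨k, hk⟩ := h2 p (mem_univ _)
    exact ⟨k, mem_biUnion (x := p) ((Metric.ball_subset_ball hrl').trans hk)
      (Metric.mem_ball_self hrp)⟩
  · refine mem_biUnion (x := A.emb y) ?_ (Metric.mem_ball_self hrp)
    have := h1 (cubeCenter n) y
    rw [cubeScale_zero] at this
    exact (Metric.ball_subset_ball hrl).trans this
  · intro k b hb
    simp only [mem_iUnion] at hb
    obtain ⟨p, hp, hb⟩ := hb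
    refine Subset.trans (Metric.ball_subset_ball' ?_) hp
    have := Metric.mem_ball.1 hb
    linarith

namespace GoodCover

variable (C : GoodCover A)

omit [CompactSpace M] in
theorem closure_subset (k : Fin A.ν) : closure (C.O k) ⊆ A.chartDomain k := by
  intro p hp
  obtain ⟨b, hb, hd⟩ := Metric.mem_closure_iff.1 hp C.r C.r_pos
  exact C.ball_subset k b hb hd

omit [CompactSpace M] in
theorem subset_chartDomain (k : Fin A.ν) : C.O k ⊆ A.chartDomain k :=
  subset_closure.trans (C.closure_subset k)

end GoodCover

/-! ### Independence of a transition from the intermediate chart -/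

/-- In the vicinity of `y`, every transition from the chart of `y` to the `j`-th chart through
the `k`-th chart is a transition through the `k'`-th chart. -/
def SameGerm (y : A.Transversal) (j k k' : Fin A.ν) : Prop :=
  ∀ᶠ y' in 𝓝 y, ∀ v z : A.Transversal, v.1 = k → z.1 = j → A.Meets y' v → A.Meets v z →
    ∃ v' : A.Transversal, v'.1 = k' ∧ A.Meets y' v' ∧ A.Meets v' z

omit [CompactSpace M] in
theorem eventually_triple {q : M} {y u u' : A.Transversal} (hy : q ∈ A.closedPlaque y)
    (hu : q ∈ A.plaque u) (hu' : q ∈ A.plaque u') :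
    ∀ᶠ y' in 𝓝 y, ∃ v v' : A.Transversal, v.1 = u.1 ∧ v'.1 = u'.1 ∧
      A.Meets y' v ∧ A.Meets y' v' ∧ A.Meets v v' := by
  obtain ⟨a, ha, h1, h2⟩ := exists_param_mem hy
    ((A.isOpen_chartDomain u.1).inter (A.isOpen_chartDomain u'.1))
    ⟨A.plaque_subset_chartDomain u hu, A.plaque_subset_chartDomain u' hu'⟩
  have hc : Continuous fun y' => A.param (a, y') :=
    A.continuous_param.comp (continuous_const.prodMk continuous_id)
  filter_upwards [hc.continuousAt.eventually_mem ((A.isOpen_chartDomain u.1).mem_nhds h1),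
    hc.continuousAt.eventually_mem ((A.isOpen_chartDomain u'.1).mem_nhds h2)] with y' h3 h4
  obtain ⟨v, hv, hv'⟩ := A.mem_chartDomain.1 h3
  obtain ⟨v1, hv1, hv1'⟩ := A.mem_chartDomain.1 h4
  exact ⟨v, v1, hv, hv1, ⟨_, A.param_mem_plaque ha y', hv'⟩, ⟨_, A.param_mem_plaque ha y', hv1'⟩,
    ⟨_, hv', hv1'⟩⟩

/-- Near `q` the two intermediate plaques meet each other, both along the plaque of `y` and along
that of `z`. Uniqueness of plaques identifies the two pictures. -/
theorem sameGerm_of_mem {q : M} {y z : A.Transversal} (hy : q ∈ A.closedPlaque y)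
    (hz : q ∈ A.closedPlaque z) {k k' : Fin A.ν} (hk : q ∈ A.chartDomain k)
    (hk' : q ∈ A.chartDomain k') : SameGerm y z.1 k k' := by
  obtain ⟨u, rfl, hu⟩ := A.mem_chartDomain.1 hk
  obtain ⟨u', rfl, hu'⟩ := A.mem_chartDomain.1 hk'
  have h1 := eventually_triple hy hu hu'
  have h2 := eventually_triple hz hu hu'
  have h3 : A.ClosedMeets u z := ⟨q, A.plaque_subset u hu, hz⟩
  have h4 : A.ClosedMeets y u := ⟨q, hy, A.plaque_subset u hu⟩
  filter_upwards [h1, h4.eventually (h3.eventually h2)] with y' ⟨t, t', ht, ht', m1, m2, m3⟩ h5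
    v z' hv hz' n1 n2
  obtain rfl : t = v := m1.closed.unique n1.closed (ht.trans hv.symm)
  obtain ⟨s, s', hs, hs', l1, l2, l3⟩ := h5 t hv n1.closed z' hz' n2.closed
  obtain rfl : s = t := l1.closed.unique n2.symm.closed (hs.trans ht.symm)
  obtain rfl : s' = t' := l3.closed.unique m3.closed (hs'.trans ht'.symm)
  exact ⟨s', hs', m2, l2.symm⟩

/-- Local independence of the intermediate chart propagates from `q` to `q'` because the
intersection of the closed plaques is connected. -/
theorem sameGerm_of_mem_mem {q q' : M} {y z : A.Transversal} (hy : q ∈ A.closedPlaque y)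
    (hz : q ∈ A.closedPlaque z) (hy' : q' ∈ A.closedPlaque y) (hz' : q' ∈ A.closedPlaque z)
    {k k' : Fin A.ν} (hk : q ∈ A.chartDomain k) (hk' : q' ∈ A.chartDomain k') :
    SameGerm y z.1 k k' := by
  have hpre : IsPreconnected (A.closedPlaque y ∩ A.closedPlaque z) :=
    A.plaque_inter_connected y.1 z.1 y.2 z.2
  refine hpre.induction₂' (fun p p' => ∀ k k', p ∈ A.chartDomain k → p' ∈ A.chartDomain k' →
    SameGerm y z.1 k k') ?_ ?_ ⟨hy, hz⟩ ⟨hy', hz'⟩ k k' hk hk'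
  · intro p hp
    have h1 : ∀ᶠ p' in 𝓝[A.closedPlaque y ∩ A.closedPlaque z] p,
        ∀ k, p ∈ A.chartDomain k → p' ∈ A.chartDomain k := by
      refine Filter.eventually_all.2 fun k => ?_
      by_cases h : p ∈ A.chartDomain k
      · filter_upwards [mem_nhdsWithin_of_mem_nhds ((A.isOpen_chartDomain k).mem_nhds h)]
          with p' hp' _ using hp'
      · exact Filter.Eventually.of_forall fun p' h' => absurd h' h
    filter_upwards [h1, self_mem_nhdsWithin] with p' hp' hm
    exact ⟨fun k k' hk hk' => sameGerm_of_mem hm.1 hm.2 (hp' k hk) hk',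
      fun k k' hk hk' => sameGerm_of_mem hm.1 hm.2 hk (hp' k' hk')⟩
  · intro p1 p2 p3 _ _ _ h12 h23 k k' hk hk'
    obtain ⟨l, hl⟩ := A.cover p2
    filter_upwards [h12 k l hk hl, h23 l k' hl hk'] with y' h1 h2 v z' hv hz' m1 m2
    obtain ⟨v', hv', m1', m2'⟩ := h1 v z' hv hz' m1 m2
    exact h2 v' z' hv' hz' m1' m2'

namespace GoodCover

variable (C : GoodCover A)

/-- The closed plaque of `y` meets a closed plaque of the `j`-th chart within the closure of the
`k`-th member of the cover. -/
def MeetsNear (y : A.Transversal) (j k : Fin A.ν) : Prop :=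
  ∃ (z : A.Transversal) (q : M), z.1 = j ∧ q ∈ A.closedPlaque y ∧ q ∈ A.closedPlaque z ∧
    q ∈ closure (C.O k)

theorem isClosed_meetsNear (j k : Fin A.ν) : IsClosed {y | C.MeetsNear y j k} := by
  have h : IsClosed {p : A.Transversal × A.Transversal × M |
      p.2.1.1 = j ∧ p.2.2 ∈ A.closedPlaque p.1 ∧ p.2.2 ∈ A.closedPlaque p.2.1 ∧
        p.2.2 ∈ closure (C.O k)} :=
    ((isClosed_index j).preimage (f := fun p : A.Transversal × A.Transversal × M => p.2.1)
      (by fun_prop)).inter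
    ((A.isClosed_closedPlaque.preimage
      (f := fun p : A.Transversal × A.Transversal × M => (p.2.2, p.1)) (by fun_prop)).inter
    ((A.isClosed_closedPlaque.preimage
      (f := fun p : A.Transversal × A.Transversal × M => (p.2.2, p.2.1)) (by fun_prop)).inter
    (isClosed_closure.preimage
      (f := fun p : A.Transversal × A.Transversal × M => p.2.2) (by fun_prop))))
  have h2 := isClosedMap_fst_of_compactSpace _ h
  convert h2 using 1
  ext y
  simp only [MeetsNear, mem_ofPred_eq, mem_image, Prod.exists, exists_and_right, exists_eq_right]

/-- A direct transition equals the detour through a chart around `q`, at a uniform scale. Near each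
`y₀` only finitely many germ identities are needed, one for each triple of charts, and a Lebesgue
number makes their neighbourhoods uniform. `MeetsNear` is a closed condition, so no new triple
appears near `y₀`. -/
theorem exists_agreement : ∃ δ : ℝ≥0∞, 0 < δ ∧
    ∀ (y z y' z' v z'' : A.Transversal) (q : M), q ∈ A.closedPlaque y → q ∈ A.closedPlaque z →
      q ∈ C.O v.1 → A.ClosedMeets y' z' → z'.1 = z.1 → A.transDist y y' < δ → A.Meets y' v →
      A.Meets v z'' → z''.1 = z.1 → z'' = z' := by
  have key : ∀ y₀ : A.Transversal,
      {y | (∀ j k, ¬ C.MeetsNear y₀ j k → ¬ C.MeetsNear y j k) ∧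
        ∀ j k k', C.MeetsNear y₀ j k → C.MeetsNear y₀ j k' →
          ∀ v z : A.Transversal, v.1 = k → z.1 = j → A.Meets y v → A.Meets v z →
            ∃ v' : A.Transversal, v'.1 = k' ∧ A.Meets y v' ∧ A.Meets v' z} ∈ 𝓝 y₀ := by
    intro y₀
    refine Filter.Eventually.and ?_ ?_
    · refine Filter.eventually_all.2 fun j => Filter.eventually_all.2 fun k => ?_
      by_cases h : C.MeetsNear y₀ j k
      · exact Filter.Eventually.of_forall fun y h' => absurd h h'
      · filter_upwards [(C.isClosed_meetsNear j k).isOpen_compl.mem_nhds h] with y hy _ using hy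
    · refine Filter.eventually_all.2 fun j => Filter.eventually_all.2 fun k =>
        Filter.eventually_all.2 fun k' => ?_
      by_cases h : C.MeetsNear y₀ j k ∧ C.MeetsNear y₀ j k'
      · obtain ⟨⟨z, q, hz, h1, h2, h3⟩, ⟨z', q', hz', h1', h2', h3'⟩⟩ := h
        obtain rfl : z = z' := ClosedMeets.unique ⟨q, h1, h2⟩ ⟨q', h1', h2'⟩ (hz.trans hz'.symm)
        subst hz
        filter_upwards [sameGerm_of_mem_mem h1 h2 h1' h2' (C.closure_subset k h3)
          (C.closure_subset k' h3')] with y hy _ _ using hy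
      · exact Filter.Eventually.of_forall fun y h1 h2 => absurd ⟨h1, h2⟩ h
  obtain ⟨δ, hδ, H⟩ := A.exists_lebesgue_number key
  refine ⟨δ, hδ, fun y z y' z' v z'' q hy hz hq hm hi hd hv hv' hi' => ?_⟩
  obtain ⟨y₀, hy₀⟩ := H y
  have e1 := hy₀ y (by rw [transDist_self]; exact hδ)
  have e2 := hy₀ y' hd
  have n1 : C.MeetsNear y₀ z.1 v.1 := by
    by_contra hc
    exact e1.1 _ _ hc ⟨z, q, rfl, hy, hz, subset_closure hq⟩
  obtain ⟨q', hq1, hq2⟩ := hm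
  obtain ⟨k', hk'⟩ := C.cover q'
  have n2 : C.MeetsNear y₀ z.1 k' := by
    by_contra hc
    exact e2.1 _ _ hc ⟨z', q', hi, hq1, hq2, subset_closure hk'⟩
  obtain ⟨u, hu, hqu⟩ := A.mem_chartDomain.1 (C.subset_chartDomain k' hk')
  obtain ⟨v', hv1, hv2, hv3⟩ := e2.2 _ _ _ n1 n2 v z'' rfl hi' hv hv'
  obtain rfl : u = v' := (meets_of_mem hq1 hqu).closed.unique hv2.closed (hu.trans hv1.symm)
  exact hv3.closed.unique (meets_of_mem hq2 hqu).symm.closed (hi'.trans hi.symm)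

/-- A direct transition has no uniform domain, since two plaques may overlap only close to their
boundaries. The detour through the chart of `v` has one: this chart contains `q` with a margin,
which controls entering it and also leaving it. -/
theorem exists_uniform_step : ∃ δ : ℝ≥0∞, 0 < δ ∧
    (∀ (a : Cube n) (y v y' : A.Transversal), A.param (a, y) ∈ A.plaque v →
      A.param (a, y) ∈ C.O v.1 → A.transDist y y' < δ →
      ∃ v' : A.Transversal, v'.1 = v.1 ∧ A.param (a, y') ∈ A.plaque v') ∧
    (∀ (q : M) (y v v' : A.Transversal), q ∈ A.closedPlaque y → q ∈ A.plaque v → q ∈ C.O v.1 →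
      A.transDist v v' < δ → ∃ y' : A.Transversal, y'.1 = y.1 ∧ A.Meets v' y') := by
  obtain ⟨δ₁, hδ₁, H1⟩ := A.exists_param_close C.r_pos
  -- Scaling by `s` moves points by less than the margin, so `q` stays in the chart of `v`, while it
  -- acquires a uniform distance `l` from the boundary of the chart of `y`.
  obtain ⟨s, hs, hs1⟩ : ∃ s : unitInterval, s < 1 ∧ ∀ q ∈ (univ : Set (Cube n × A.Transversal)),
      dist (A.param (cubeScale s q.1, q.2)) (A.param q) < C.r := by
    have h0 : ∀ᶠ s in 𝓝 (1 : unitInterval), ∀ q ∈ (univ : Set (Cube n × A.Transversal)),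
        dist (A.param (cubeScale s q.1, q.2)) (A.param q) < C.r := by
      refine isCompact_univ.eventually_forall_of_forall_eventually fun q _ => ?_
      have hc : Continuous fun p : unitInterval × Cube n × A.Transversal =>
          dist (A.param (cubeScale p.1 p.2.1, p.2.2)) (A.param p.2) :=
        (A.continuous_param.comp ((continuous_cubeScale.comp
          (continuous_fst.prodMk (continuous_fst.comp continuous_snd))).prodMk
          (continuous_snd.comp continuous_snd))).dist (A.continuous_param.comp continuous_snd)
      refine hc.continuousAt.eventually_lt_const ?_
      simpa [cubeScale_one] using C.r_pos
    have h2 : (𝓝[<] (1 : unitInterval)).NeBot :=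
      nhdsLT_neBot_of_exists_lt ⟨0, by exact zero_lt_one⟩
    obtain ⟨s, h3, h4⟩ := ((h0.filter_mono nhdsWithin_le_nhds).and
      (self_mem_nhdsWithin : Iio (1 : unitInterval) ∈ 𝓝[<] 1)).exists
    exact ⟨s, h4, h3⟩
  obtain ⟨l, hl, H2⟩ := A.exists_ball_subset_chartDomain hs
  obtain ⟨δ₂, hδ₂, H3⟩ := A.exists_param_close hl
  refine ⟨min δ₁ δ₂, lt_min hδ₁ hδ₂, ?_, ?_⟩
  · intro a y v y' hp hq hd
    have := H1 a y y' (hd.trans_le (min_le_left _ _))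
    obtain ⟨v', h1, h2⟩ := A.mem_chartDomain.1
      (C.ball_subset _ _ hq (Metric.mem_ball'.2 this))
    exact ⟨v', h1, h2⟩
  · intro q y v v' hy hv hq hd
    obtain ⟨a, rfl⟩ := A.mem_closedPlaque.1 hy
    have h1 := C.ball_subset _ _ hq (Metric.mem_ball.2 (hs1 (a, y) (mem_univ _)))
    obtain ⟨v1, hv1, hv2⟩ := A.mem_chartDomain.1 h1
    obtain rfl : v1 = v := ClosedMeets.unique (y := y)
      ⟨_, A.param_mem_closedPlaque _ y, A.plaque_subset _ hv2⟩ ⟨_, hy, A.plaque_subset _ hv⟩ hv1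
    obtain ⟨c, hc, hc2⟩ := A.mem_plaque.1 hv2
    have h2 := H3 c v1 v' (hd.trans_le (min_le_right _ _))
    rw [hc2] at h2
    obtain ⟨y', h3, h4⟩ := A.mem_chartDomain.1 (H2 a y (Metric.mem_ball'.2 h2))
    exact ⟨y', h3, _, A.param_mem_plaque hc v', h4⟩

end GoodCover

end RegularAtlas

namespace RegularAtlas

variable {n : ℕ} {M : Type u} [MetricSpace M] [CompactSpace M] {A : RegularAtlas n M}

/-! ### Uniform domains and invariant partitions -/

/-- Under equicontinuity, the holonomy along a word extends, along another word, to a ball of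
uniform radius. -/
theorem IsEquicontinuous.exists_extension (h : A.IsEquicontinuous) :
    ∃ δ : ℝ≥0∞, 0 < δ ∧ ∀ (w : List (Fin A.ν)) (y z : A.Transversal), A.chainRel w y z →
      ∃ w' : List (Fin A.ν), ∀ y', A.transDist y y' < δ →
        ∃ z', A.chainRel w' y' z' ∧ ∀ z'', A.chainRel w y' z'' → z'' = z' := by
  obtain ⟨C⟩ := A.exists_goodCover
  obtain ⟨δ₁, hδ₁, H1⟩ := C.exists_agreement
  obtain ⟨δ₂, hδ₂, H2, H3⟩ := C.exists_uniform_step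
  obtain ⟨δ, hδ, H⟩ := h.chainRel (lt_min hδ₁ hδ₂)
  refine ⟨δ, hδ, ?_⟩
  -- Here `u` is the detoured word built so far, defined on the ball about `x`, and `w` is what
  -- remains. Equicontinuity is applied to all of `u` at once, so errors do not accumulate.
  have key : ∀ (w : List (Fin A.ν)) (y z : A.Transversal), A.chainRel w y z →
      ∀ (x : A.Transversal) (u : List (Fin A.ν)), A.chainRel u x y →
      (∀ x', A.transDist x x' < δ → ∃ y', A.chainRel u x' y') →
      ∃ w' : List (Fin A.ν), ∀ x', A.transDist x x' < δ → ∀ y', A.chainRel u x' y' →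
        ∃ z', A.chainRel w' x' z' ∧ ∀ z'', A.chainRel w y' z'' → z'' = z' := by
    intro w
    induction w with
    | nil => intro y z hw; exact hw.elim
    | cons i w ih =>
      cases w with
      | nil =>
        intro y z _ x u _ _
        exact ⟨u, fun x' _ y' hy' => ⟨y', hy', fun z'' hz => hz.2.symm⟩⟩
      | cons j w =>
        rintro y z ⟨hyi, y1, ⟨q, hq, hq1⟩, hw⟩ x u hu hdom
        -- The next transition is replaced by a detour through a chart `k` around the common point
        -- `q`.
        obtain ⟨k, hk⟩ := C.cover q
        obtain ⟨v, rfl, hv⟩ := A.mem_chartDomain.1 (C.subset_chartDomain k hk)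
        have hyv : A.Meets y v := ⟨q, hq, hv⟩
        have hvy : A.Meets v y1 := ⟨q, hv, hq1⟩
        have hj : y1.1 = j := chainRel_head hw
        have step : ∀ x', A.transDist x x' < δ → ∀ y', A.chainRel u x' y' →
            ∃ v' y1' : A.Transversal, v'.1 = v.1 ∧ y1'.1 = y1.1 ∧ A.Meets y' v' ∧ A.Meets v' y1' := by
          intro x' hx' y' hy'
          have hd := H u x x' y y' hu hy' hx'
          obtain ⟨a, ha, rfl⟩ := A.mem_plaque.1 hq
          obtain ⟨v', hv', hv2⟩ := H2 a y v y' hv hk (hd.trans_le (min_le_right _ _))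
          have hm : A.Meets y' v' := ⟨_, A.param_mem_plaque ha y', hv2⟩
          have hd' := H (u ++ [v.1]) x x' v v' (chainRel_snoc hu hyv)
            (hv' ▸ chainRel_snoc hy' hm) hx'
          obtain ⟨y1', h1, h2⟩ := H3 _ y1 v v' (A.plaque_subset _ hq1) hv hk
            (hd'.trans_le (min_le_right _ _))
          exact ⟨v', y1', hv', h1, hm, h2⟩
        have hu' : A.chainRel (u ++ [v.1] ++ [y1.1]) x y1 :=
          chainRel_snoc (chainRel_snoc hu hyv) hvy
        have snoc : ∀ (x' y' v' y1' : A.Transversal), A.chainRel u x' y' → v'.1 = v.1 →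
            y1'.1 = y1.1 → A.Meets y' v' → A.Meets v' y1' →
            A.chainRel (u ++ [v.1] ++ [y1.1]) x' y1' := by
          intro x' y' v' y1' h1 h2 h3 h4 h5
          rw [← h2, ← h3]
          exact chainRel_snoc (chainRel_snoc h1 h4) h5
        obtain ⟨w', hw'⟩ := ih y1 z hw x _ hu' (fun x' hx' => by
          obtain ⟨y', hy'⟩ := hdom x' hx'
          obtain ⟨v', y1', h1, h2, h3, h4⟩ := step x' hx' y' hy'
          exact ⟨y1', snoc x' y' v' y1' hy' h1 h2 h3 h4⟩)
        refine ⟨w', fun x' hx' y' hy' => ?_⟩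
        obtain ⟨v', y1', h1, h2, h3, h4⟩ := step x' hx' y' hy'
        obtain ⟨z', hz', hz2⟩ := hw' x' hx' y1' (snoc x' y' v' y1' hy' h1 h2 h3 h4)
        refine ⟨z', hz', ?_⟩
        rintro z'' ⟨-, t, ht, htw⟩
        have hd := H u x x' y y' hu hy' hx'
        have htj : t.1 = y1.1 := (chainRel_head htw).trans hj.symm
        have e : y1' = t := H1 y y1 y' t v' y1' q (A.plaque_subset _ hq) (A.plaque_subset _ hq1)
          (h1 ▸ hk) (Meets.closed ht) htj (hd.trans_le (min_le_left _ _)) h3 h4 h2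
        subst e
        exact hz2 z'' htw
  intro w y z hw
  obtain ⟨w', hw'⟩ := key w y z hw y [y.1] (chainRel_refl y) (fun y' hy' =>
    ⟨y', (index_eq_of_transDist_lt hy').symm, rfl⟩)
  exact ⟨w', fun y' hy' => hw' y' hy' y' ⟨(index_eq_of_transDist_lt hy').symm, rfl⟩⟩

/-- Finitely many small clopen sets cover the transversal; the classes are their membership
patterns. -/
theorem exists_fine_setoid (A : RegularAtlas n M) {ε : ℝ≥0∞} (hε : 0 < ε) :
    ∃ P : Setoid A.Transversal, (∀ y, ∀ᶠ z in 𝓝 y, P y z) ∧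
      ∀ y z, P y z → A.transDist y z < ε := by
  have hε2 : 0 < ε / 2 := ENNReal.half_pos hε.ne'
  have h1 : ∀ y : A.Transversal, ∃ K : Set A.Transversal, IsClopen K ∧ y ∈ K ∧
      K ⊆ {z | A.transDist y z < ε / 2} := by
    intro y
    obtain ⟨V, hVs, hVo, hy⟩ := mem_nhds_iff.1 (A.eventually_transDist_lt y hε2)
    obtain ⟨K, hK, hyK, hKV⟩ := compact_exists_isClopen_in_isOpen hVo hy
    exact ⟨K, hK, hyK, hKV.trans hVs⟩
  choose K hK hyK hKs using h1
  obtain ⟨t, ht⟩ := isCompact_univ.elim_finite_subcover K (fun y => (hK y).isOpen)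
    (fun y _ => mem_iUnion.2 ⟨y, hyK y⟩)
  refine ⟨⟨fun y z => ∀ c ∈ t, y ∈ K c ↔ z ∈ K c, fun _ _ _ => Iff.rfl,
    fun h c hc => (h c hc).symm, fun h h' c hc => (h c hc).trans (h' c hc)⟩, fun y => ?_, ?_⟩
  · refine (Filter.eventually_all_finset t).2 fun c _ => ?_
    by_cases hy : y ∈ K c
    · filter_upwards [(hK c).isOpen.mem_nhds hy] with z hz using by simp [hy, hz]
    · filter_upwards [(hK c).compl.isOpen.mem_nhds hy] with z hz
      exact ⟨fun h => absurd h hy, fun h => absurd h hz⟩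
  · intro y z h
    obtain ⟨c, hc, hyc⟩ := mem_iUnion₂.1 (ht (mem_univ y))
    have h1 := hKs c hyc
    have h2 := hKs c ((h c hc).1 hyc)
    calc A.transDist y z ≤ A.transDist y c + A.transDist c z := A.transDist_triangle _ _ _
      _ < ε / 2 + ε / 2 := ENNReal.add_lt_add (by rw [transDist_comm]; exact h1) h2
      _ = ε := ENNReal.add_halves ε

/-- An equivalence relation on the transversal, with open classes and invariant under the
holonomy. -/
structure InvariantRel (A : RegularAtlas n M) where
  /-- the equivalence relation -/
  rel : Setoid A.Transversal
  eventually_rel : ∀ y, ∀ᶠ z in 𝓝 y, rel y z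
  invariant : ∀ {w : List (Fin A.ν)} {y z y' z' : A.Transversal}, A.chainRel w y z →
    A.chainRel w y' z' → rel y y' → rel z z'

namespace InvariantRel

omit [CompactSpace M] in
theorem invariant_meets (R : InvariantRel A) {y z y' z' : A.Transversal} (h : A.Meets y z)
    (h' : A.Meets y' z') (hy : y'.1 = y.1) (hz : z'.1 = z.1) (hR : R.rel y y') : R.rel z z' :=
  R.invariant (w := [y.1, z.1]) ⟨rfl, z, h, rfl, rfl⟩ ⟨hy, z', h', hz, rfl⟩ hR

/-- The common refinement of two invariant relations. -/
def inf (R S : InvariantRel A) : InvariantRel A where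
  rel := R.rel ⊓ S.rel
  eventually_rel y := (R.eventually_rel y).and (S.eventually_rel y)
  invariant h h' hR := ⟨R.invariant h h' hR.1, S.invariant h h' hR.2⟩

omit [CompactSpace M] in
theorem isOpen_class (R : InvariantRel A) (y : A.Transversal) : IsOpen {z | R.rel y z} := by
  rw [isOpen_iff_mem_nhds]
  intro z hz
  filter_upwards [R.eventually_rel z] with t ht
  exact R.rel.trans hz ht

omit [CompactSpace M] in
theorem isClosed_class (R : InvariantRel A) (y : A.Transversal) : IsClosed {z | R.rel y z} := by
  rw [← isOpen_compl_iff, isOpen_iff_mem_nhds]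
  intro z hz
  filter_upwards [R.eventually_rel z] with t ht h
  exact hz (R.rel.trans h (R.rel.symm ht))

end InvariantRel

/-- Points are equivalent if they have the same itinerary through a fine clopen partition `P`.
Equicontinuity makes the classes open, and extension of words makes the relation invariant. -/
theorem IsEquicontinuous.exists_invariantRel (h : A.IsEquicontinuous) {ε : ℝ≥0∞} (hε : 0 < ε) :
    ∃ R : InvariantRel A, ∀ y z, R.rel y z → A.transDist y z < ε := by
  obtain ⟨δ, hδ, H⟩ := h.exists_extension
  obtain ⟨P, hP, hPs⟩ := A.exists_fine_setoid (lt_min hδ hε)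
  have hPδ : ∀ y z, P y z → A.transDist y z < δ := fun y z hyz =>
    (hPs y z hyz).trans_le (min_le_left _ _)
  obtain ⟨ε', hε', HL⟩ := A.exists_lebesgue_number hP
  have HL' : ∀ y z, A.transDist y z < ε' → P y z := by
    intro y z hyz
    obtain ⟨c, hc⟩ := HL y
    exact P.trans (P.symm (hc y (by rw [transDist_self]; exact hε'))) (hc z hyz)
  obtain ⟨δ', hδ', HE⟩ := h.chainRel hε'
  -- Only words defined on the whole `P`-class are tested; otherwise transitivity would fail at a
  -- middle point outside the domain.
  refine ⟨⟨⟨fun y z => P y z ∧ ∀ w : List (Fin A.ν), (∀ t, P y t → ∃ t', A.chainRel w t t') →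
    ∀ y' z', A.chainRel w y y' → A.chainRel w z z' → P y' z', ⟨?_, ?_, ?_⟩⟩, ?_, ?_⟩, ?_⟩
  · intro y
    refine ⟨P.refl y, fun w _ y' z' h1 h2 => ?_⟩
    rw [chainRel_unique h1 h2]
  · rintro y z ⟨h1, h2⟩
    exact ⟨P.symm h1, fun w hw y' z' h3 h4 =>
      P.symm (h2 w (fun t ht => hw t (P.trans (P.symm h1) ht)) z' y' h4 h3)⟩
  · rintro y z t ⟨h1, h2⟩ ⟨h3, h4⟩
    refine ⟨P.trans h1 h3, fun w hw y' t' h5 h6 => ?_⟩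
    obtain ⟨z', hz'⟩ := hw z h1
    exact P.trans (h2 w hw y' z' h5 hz')
      (h4 w (fun s hs => hw s (P.trans h1 hs)) z' t' hz' h6)
  · intro y
    filter_upwards [hP y, A.eventually_transDist_lt y hδ'] with z h1 h2
    exact ⟨h1, fun w _ y' z' h3 h4 => HL' _ _ (HE w y z y' z' h3 h4 h2)⟩
  · rintro w y z y' z' hw hw' ⟨h1, h2⟩
    -- The word `w` may be undefined on part of the class, but its extension `w'` is defined there
    -- and has the same values at `y` and `y'`.
    have ext : ∀ (w : List (Fin A.ν)) (z z' : A.Transversal), A.chainRel w y z →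
        A.chainRel w y' z' → P z z' := by
      intro w z z' hw hw'
      obtain ⟨w', hw1⟩ := H w y z hw
      obtain ⟨s, hs, hs2⟩ := hw1 y (hPδ _ _ (P.refl y))
      obtain ⟨s', hs', hs2'⟩ := hw1 y' (hPδ _ _ h1)
      obtain rfl := hs2 z hw
      obtain rfl := hs2' z' hw'
      exact h2 w' (fun t ht => (hw1 t (hPδ _ _ ht)).imp fun _ hh => hh.1) _ _ hs hs'
    refine ⟨ext w z z' hw hw', fun u _ z1 z1' h3 h4 => ?_⟩
    cases u with
    | nil => exact h3.elim
    | cons k u => exact ext (w ++ u) z1 z1' (chainRel_comp hw h3) (chainRel_comp hw' h4)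
  · exact fun y z hyz => (hPs y z hyz.1).trans_le (min_le_right _ _)

/-! ### Minimality -/

theorem eventually_of_mem_plaque {p : M} {y : A.Transversal} (hp : p ∈ A.plaque y)
    {W : Set A.Transversal} (hW : W ∈ 𝓝 y) :
    ∀ᶠ p' in 𝓝 p, ∃ y' ∈ W, y'.1 = y.1 ∧ p' ∈ A.plaque y' := by
  have hcl : IsClosed {q : M × A.Transversal |
      q.1 ∈ A.closedPlaque q.2 ∧ q.2.1 = y.1 ∧ q.2 ∈ (interior W)ᶜ} :=
    A.isClosed_closedPlaque.inter (((isClosed_index y.1).preimage continuous_snd).inter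
      (isOpen_interior.isClosed_compl.preimage continuous_snd))
  have h2 := isClosedMap_fst_of_compactSpace _ hcl
  filter_upwards [h2.isOpen_compl.mem_nhds (x := p) (by
    rintro ⟨⟨p', y'⟩, ⟨h1, h2, h3⟩, rfl⟩
    exact h3 (mem_interior_iff_mem_nhds.2
      ((eq_of_mem_closedPlaque h1 (A.plaque_subset y hp) h2) ▸ hW))),
    (A.isOpen_chartDomain y.1).mem_nhds (A.plaque_subset_chartDomain y hp)] with p' hp' hd
  obtain ⟨y', hi, hy'⟩ := A.mem_chartDomain.1 hd
  refine ⟨y', ?_, hi, hy'⟩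
  by_contra hc
  exact hp' ⟨(p', y'), ⟨A.plaque_subset y' hy', hi, fun hh => hc (interior_subset hh)⟩, rfl⟩

/-- The plaques of `S` and those of its complement sweep out complementary open subsets of the
connected space `M`. -/
theorem eq_univ_of_saturated [ConnectedSpace M] {S : Set A.Transversal} (hS : IsClopen S)
    (hne : S.Nonempty) (hsat : ∀ y z, A.Meets y z → y ∈ S → z ∈ S) : S = univ := by
  have hop : ∀ T : Set A.Transversal, IsOpen T → IsOpen (⋃ y ∈ T, A.plaque y) := by
    intro T hT
    rw [isOpen_iff_mem_nhds]
    intro p hp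
    obtain ⟨y, hy, hpy⟩ := mem_iUnion₂.1 hp
    filter_upwards [eventually_of_mem_plaque hpy (hT.mem_nhds hy)] with p' ⟨y', h1, _, h2⟩
    exact mem_iUnion₂.2 ⟨y', h1, h2⟩
  have hcompl : (⋃ y ∈ S, A.plaque y)ᶜ = ⋃ y ∈ Sᶜ, A.plaque y := by
    ext p
    constructor
    · intro hp
      obtain ⟨i, hi⟩ := A.cover p
      obtain ⟨y, -, hy⟩ := A.mem_chartDomain.1 hi
      exact mem_iUnion₂.2 ⟨y, fun hyS => hp (mem_iUnion₂.2 ⟨y, hyS, hy⟩), hy⟩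
    · intro hp hp'
      obtain ⟨y, hy, hpy⟩ := mem_iUnion₂.1 hp
      obtain ⟨y', hy', hpy'⟩ := mem_iUnion₂.1 hp'
      exact hy (hsat y' y ⟨p, hpy', hpy⟩ hy')
  have hcl : IsClopen (⋃ y ∈ S, A.plaque y) :=
    ⟨⟨hcompl ▸ hop _ hS.compl.isOpen⟩, hop _ hS.isOpen⟩
  obtain ⟨y₀, hy₀⟩ := hne
  have huniv := hcl.eq_univ ⟨A.emb y₀, mem_iUnion₂.2 ⟨y₀, hy₀, A.emb_mem_plaque y₀⟩⟩
  refine eq_univ_of_forall fun y => ?_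
  obtain ⟨y', hy', h⟩ := mem_iUnion₂.1 (huniv ▸ mem_univ (A.emb y))
  exact hsat y' y ⟨_, h, A.emb_mem_plaque y⟩ hy'

/-- Equicontinuous matchbox manifolds are minimal. -/
theorem IsEquicontinuous.exists_chainRel_mem [ConnectedSpace M] (h : A.IsEquicontinuous)
    {U : Set A.Transversal} (hU : IsOpen U) (hne : U.Nonempty) (y : A.Transversal) :
    ∃ (w : List (Fin A.ν)) (z : A.Transversal), A.chainRel w y z ∧ z ∈ U := by
  obtain ⟨x, hx⟩ := hne
  obtain ⟨ε, hε, hεU⟩ := A.exists_transDist_ball (hU.mem_nhds hx)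
  obtain ⟨δ, hδ, H⟩ := h.exists_extension
  obtain ⟨R, hR⟩ := h.exists_invariantRel (lt_min hε hδ)
  -- The points whose orbit visits the class of `x`. Words extend over whole classes of `R`, so `S`
  -- is a union of classes and hence clopen.
  set S : Set A.Transversal := {y | ∃ w z, A.chainRel w y z ∧ R.rel x z} with hS
  have hsat : ∀ y y', R.rel y y' → y ∈ S → y' ∈ S := by
    rintro y y' hyy ⟨w, z, hw, hz⟩
    obtain ⟨w', hw'⟩ := H w y z hw
    have hd : ∀ s, R.rel y s → A.transDist y s < δ := fun s hs =>
      (hR y s hs).trans_le (min_le_right _ _)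
    obtain ⟨s, hs, hs2⟩ := hw' y (hd y (R.rel.refl y))
    obtain ⟨s', hs', -⟩ := hw' y' (hd y' hyy)
    obtain rfl := hs2 z hw
    exact ⟨w', s', hs', R.rel.trans hz (R.invariant hs hs' hyy)⟩
  have hclopen : IsClopen S := by
    constructor
    · rw [← isOpen_compl_iff, isOpen_iff_mem_nhds]
      intro y hy
      filter_upwards [R.eventually_rel y] with z hz hzS
      exact hy (hsat z y (R.rel.symm hz) hzS)
    · rw [isOpen_iff_mem_nhds]
      intro y hy
      filter_upwards [R.eventually_rel y] with z hz
      exact hsat y z hz hy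
  have huniv := eq_univ_of_saturated hclopen ⟨x, [x.1], x, chainRel_refl x, R.rel.refl x⟩ (by
    rintro y z hm ⟨w, t, hw, ht⟩
    cases w with
    | nil => exact hw.elim
    | cons i w =>
      obtain rfl := chainRel_head hw
      exact ⟨z.1 :: y.1 :: w, t, ⟨rfl, y, hm.symm, hw⟩, ht⟩)
  obtain ⟨w, z, hw, hz⟩ := huniv ▸ mem_univ y
  exact ⟨w, z, hw, hεU z ((hR x z hz).trans_le (min_le_left _ _))⟩

end RegularAtlas

namespace RegularAtlas

variable {n : ℕ} {M : Type u} [MetricSpace M] {A : RegularAtlas n M}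

/-! ### Transverse sections -/

/-- The homeomorphisms of a subset of one local transversal which are given by a word. -/
def wordGroup (V : Set A.Transversal) (i : Fin A.ν) (hV : ∀ y ∈ V, y.1 = i) :
    Subgroup (V ≃ₜ V) where
  carrier := {g | ∃ w : List (Fin A.ν), ∀ y : V, A.chainRel w y (g y : A.Transversal)}
  one_mem' := ⟨[i], fun y => ⟨hV y y.2, rfl⟩⟩
  mul_mem' := by
    rintro g g' ⟨w, hw⟩ ⟨w', hw'⟩
    cases w with
    | nil => exact ⟨[i], fun y => (hw y).elim⟩
    | cons k w => exact ⟨w' ++ w, fun y => chainRel_comp (hw' y) (hw (g' y))⟩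
  inv_mem' := by
    rintro g ⟨w, hw⟩
    refine ⟨w.reverse, fun y => ?_⟩
    have h := chainRel_reverse (hw (g.symm y))
    rw [g.apply_symm_apply] at h
    exact h

variable [CompactSpace M]

theorem InvariantRel.finite_classes (R : InvariantRel A) :
    {K : Set A.Transversal | ∃ y, K = {z | R.rel y z}}.Finite := by
  obtain ⟨t, ht⟩ := isCompact_univ.elim_finite_subcover (fun y => {z | R.rel y z})
    R.isOpen_class (fun y _ => mem_iUnion.2 ⟨y, R.rel.refl y⟩)
  refine (t.finite_toSet.image fun y => {z | R.rel y z}).subset ?_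
  rintro _ ⟨y, rfl⟩
  obtain ⟨c, hc, hcy⟩ := mem_iUnion₂.1 (ht (mem_univ y))
  refine ⟨c, hc, ?_⟩
  ext z
  exact ⟨fun h => R.rel.trans (R.rel.symm hcy) h, fun h => R.rel.trans hcy h⟩

/-- Radii for which the holonomy along every word extends to balls. -/
def IsExtensionRadius (A : RegularAtlas n M) (δ : ℝ≥0∞) : Prop :=
  ∀ (w : List (Fin A.ν)) (y z : A.Transversal), A.chainRel w y z →
    ∃ w' : List (Fin A.ν), ∀ y', A.transDist y y' < δ →
      ∃ z', A.chainRel w' y' z' ∧ ∀ z'', A.chainRel w y' z'' → z'' = z'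

section Section

variable {δ : ℝ≥0∞} (H : IsExtensionRadius A δ) (R : InvariantRel A)
  (hR : ∀ y z, R.rel y z → A.transDist y z < δ) (x : A.Transversal)

include hR in
omit [CompactSpace M] in
theorem index_eq_of_rel {y : A.Transversal} (hy : y ∈ {z | R.rel x z}) : y.1 = x.1 :=
  (index_eq_of_transDist_lt (hR x y hy)).symm

include H in
-- The extension `w₁` of `w` maps the class into itself by invariance, and the extension `w₂` of the
-- reverse of `w₁` is its inverse. Both are single words, so no gluing is involved.
theorem exists_mem_wordGroup {w : List (Fin A.ν)} {y z : A.Transversal} (hy : R.rel x y)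
    (hz : R.rel x z) (hw : A.chainRel w y z) :
    ∃ g ∈ wordGroup {z | R.rel x z} x.1 (fun _ => index_eq_of_rel R hR x),
      ∀ (y' : {z | R.rel x z}) (z' : A.Transversal), A.chainRel w y' z' →
        z' = (g y' : A.Transversal) := by
  obtain ⟨w₁, h1⟩ := H w y z hw
  have hd : ∀ {s t}, R.rel x s → R.rel x t → A.transDist s t < δ := fun hs ht =>
    hR _ _ (R.rel.trans (R.rel.symm hs) ht)
  have hw₁ : A.chainRel w₁ y z := by
    obtain ⟨s, hs, hs2⟩ := h1 y (hd hy hy)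
    exact (hs2 z hw) ▸ hs
  obtain ⟨w₂, h2⟩ := H _ _ _ (chainRel_reverse hw₁)
  have hw₂ : A.chainRel w₂ z y := by
    obtain ⟨s, hs, hs2⟩ := h2 z (hd hz hz)
    exact (hs2 y (chainRel_reverse hw₁)) ▸ hs
  have e1 : ∀ y' : {z | R.rel x z}, A.chainRel w₁ y' (wordFun w₁ y') := fun y' =>
    chainRel_wordFun ((h1 y' (hd hy y'.2)).imp fun _ h => h.1)
  have e2 : ∀ y' : {z | R.rel x z}, A.chainRel w₂ y' (wordFun w₂ y') := fun y' =>
    chainRel_wordFun ((h2 y' (hd hz y'.2)).imp fun _ h => h.1)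
  have m1 : ∀ y' : {z | R.rel x z}, R.rel x (wordFun w₁ y') := fun y' =>
    R.rel.trans hz (R.invariant hw₁ (e1 y') (R.rel.trans (R.rel.symm hy) y'.2))
  have m2 : ∀ y' : {z | R.rel x z}, R.rel x (wordFun w₂ y') := fun y' =>
    R.rel.trans hy (R.invariant hw₂ (e2 y') (R.rel.trans (R.rel.symm hz) y'.2))
  have e3 : ∀ y' : {z | R.rel x z}, A.chainRel w₂ (wordFun w₁ y') (y' : A.Transversal) := by
    intro y'
    obtain ⟨s, hs, hs2⟩ := h2 _ (hd hz (m1 y'))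
    exact (hs2 _ (chainRel_reverse (e1 y'))) ▸ hs
  refine ⟨⟨⟨fun y' => ⟨wordFun w₁ y', m1 y'⟩, fun y' => ⟨wordFun w₂ y', m2 y'⟩,
    fun y' => Subtype.ext (wordFun_eq (e3 y')), fun y' => Subtype.ext ?_⟩, ?_, ?_⟩,
    ⟨w₁, e1⟩, fun y' z' h => ?_⟩
  · exact chainRel_injective (e3 ⟨_, m2 y'⟩) (e2 y')
  · refine Continuous.subtype_mk (continuous_iff_continuousAt.2 fun y' => ?_) _
    exact (continuousAt_wordFun ⟨_, e1 y'⟩).comp continuous_subtype_val.continuousAt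
  · refine Continuous.subtype_mk (continuous_iff_continuousAt.2 fun y' => ?_) _
    exact (continuousAt_wordFun ⟨_, e2 y'⟩).comp continuous_subtype_val.continuousAt
  · obtain ⟨s, hs, hs2⟩ := h1 y' (hd hy y'.2)
    rw [hs2 z' h]
    exact (wordFun_eq hs).symm

/-- The exponent `l + 1` leaves room for the strict diameter bound: a supremum of distances below
`2⁻¹ ^ (l + 1)` is only `≤` this number, but still `< 2⁻¹ ^ l`. -/
theorem IsEquicontinuous.exists_refinements (h : A.IsEquicontinuous)
    (hR2 : ∀ y z, R.rel y z → A.transDist y z < 2⁻¹) :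
    ∃ S : ℕ → InvariantRel A, S 0 = R ∧ (∀ l y z, (S (l + 1)).rel y z → (S l).rel y z) ∧
      ∀ l y z, (S l).rel y z → A.transDist y z < 2⁻¹ ^ (l + 1) := by
  have hpos : ∀ l : ℕ, (0 : ℝ≥0∞) < 2⁻¹ ^ (l + 1) := fun l =>
    ENNReal.pow_pos (by simp) _
  choose F hF using fun l => h.exists_invariantRel (hpos l)
  let S : ℕ → InvariantRel A := fun l =>
    Nat.rec (motive := fun _ => InvariantRel A) R (fun l T => T.inf (F (l + 1))) l
  refine ⟨S, rfl, fun l y z hyz => And.left hyz, ?_⟩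
  rintro (_ | l) y z hyz
  · simpa using hR2 y z hyz
  · exact hF (l + 1) y z (And.right hyz)

variable [ConnectedSpace M] (h : A.IsEquicontinuous)

include H h in
theorem exists_mem_wordGroup_apply_mem {y : A.Transversal} (hy : R.rel x y)
    {U : Set A.Transversal} (hU : IsOpen U) (hne : (U ∩ {z | R.rel x z}).Nonempty) :
    ∃ g ∈ wordGroup {z | R.rel x z} x.1 (fun _ => index_eq_of_rel R hR x),
      (g ⟨y, hy⟩ : A.Transversal) ∈ U := by
  obtain ⟨w, z, hw, hz⟩ := h.exists_chainRel_mem (hU.inter (R.isOpen_class x)) hne y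
  obtain ⟨g, hg, hg2⟩ := exists_mem_wordGroup H R hR x hy hz.2 hw
  exact ⟨g, hg, (hg2 ⟨y, hy⟩ z hw) ▸ hz.1⟩

omit [CompactSpace M] [ConnectedSpace M] in
theorem image_class (S : InvariantRel A)
    {g : {z | R.rel x z} ≃ₜ {z | R.rel x z}}
    (hg : g ∈ wordGroup {z | R.rel x z} x.1 (fun _ => index_eq_of_rel R hR x)) :
    g '' {y : {z | R.rel x z} | S.rel x y} =
      {y : {z | R.rel x z} | S.rel (g ⟨x, R.rel.refl x⟩) y} := by
  obtain ⟨w, hw⟩ := hg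
  ext y
  constructor
  · rintro ⟨z, hz, rfl⟩
    exact S.invariant (hw ⟨x, R.rel.refl x⟩) (hw z) hz
  · intro hy
    refine ⟨g.symm y, ?_, g.apply_symm_apply y⟩
    have h1 := chainRel_reverse (hw (g.symm y))
    rw [g.apply_symm_apply] at h1
    exact S.invariant (chainRel_reverse (hw ⟨x, R.rel.refl x⟩)) h1 hy

include H hR h in
/-- The classes of a fine invariant relation are transverse sections. -/
theorem exists_transverseSection (hR2 : ∀ y z, R.rel y z → A.transDist y z < 2⁻¹) :
    ∃ P : TransverseSection A, P.V₀ = {z | R.rel x z} ∧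
      (∀ g ∈ P.G₀, ∃ w : List (Fin A.ν), ∀ y : P.V₀, A.chainRel w y (g y : A.Transversal)) ∧
      ∀ U : Set A.Transversal, IsOpen U → (U ∩ P.V₀).Nonempty →
        ∀ y : P.V₀, ∃ g ∈ P.G₀, (g y : A.Transversal) ∈ U := by
  obtain ⟨S, hS0, hS1, hS2⟩ := h.exists_refinements R hR2
  have htrans : ∀ l, {Q : Set {z | R.rel x z} |
      ∃ g ∈ wordGroup {z | R.rel x z} x.1 (fun _ => index_eq_of_rel R hR x),
        Q = g '' {y : {z | R.rel x z} | (S l).rel x y}} =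
      (Setoid.comap (Subtype.val : {z | R.rel x z} → A.Transversal) (S l).rel).classes := by
    intro l
    ext Q
    constructor
    · rintro ⟨g, hg, rfl⟩
      rw [image_class R hR x (S l) hg]
      exact ⟨g ⟨x, R.rel.refl x⟩, by ext y; exact (S l).rel.comm'⟩
    · rintro ⟨y, rfl⟩
      obtain ⟨g, hg, hgy⟩ := exists_mem_wordGroup_apply_mem H R hR x h (R.rel.refl x)
        ((S l).isOpen_class y) ⟨y, (S l).rel.refl y, y.2⟩
      refine ⟨g, hg, ?_⟩
      rw [image_class R hR x (S l) hg]
      ext z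
      exact ⟨fun hz => (S l).rel.trans ((S l).rel.symm hgy) ((S l).rel.symm hz),
        fun hz => (S l).rel.trans ((S l).rel.symm hz) ((S l).rel.symm hgy)⟩
  refine ⟨{
    V₀ := {z | R.rel x z}
    isClopen_V₀ := ⟨R.isClosed_class x, R.isOpen_class x⟩
    G₀ := wordGroup {z | R.rel x z} x.1 (fun _ => index_eq_of_rel R hR x)
    generates := fun e => ?_
    x := ⟨x, R.rel.refl x⟩
    V := fun l => {y | (S l).rel x y}
    V_zero := ?_
    antitone_V := antitone_nat_of_succ_le fun l y hy => hS1 l _ _ hy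
    isClopen_V := fun l =>
      ⟨((S l).isClosed_class x).preimage continuous_subtype_val,
        ((S l).isOpen_class x).preimage continuous_subtype_val⟩
    iInter_V := ?_
    finite_translates := fun l => ?_
    isPartition_translates := fun l => ?_
    diam_translates := fun l g hg => ?_ }, rfl, fun g hg => hg, fun U hU hne y =>
      exists_mem_wordGroup_apply_mem H R hR x h y.2 hU hne⟩
  · constructor
    · rintro ⟨⟨w, hw⟩, hs, ht⟩
      refine ⟨hs, ?_⟩
      rcases e.source.eq_empty_or_nonempty with he | ⟨y, hy⟩
      · exact ⟨1, one_mem _, fun y hy => by simp [he] at hy⟩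
      · obtain ⟨g, hg, hg2⟩ := exists_mem_wordGroup H R hR x (hs hy) (ht (e.map_source hy))
          (hw y hy)
        exact ⟨g, hg, fun y hy => hg2 y _ (hw y hy)⟩
    · rintro ⟨hs, g, ⟨w, hw⟩, hg⟩
      have h1 : ∀ y (hy : y ∈ e.source), e y = g ⟨y, hs hy⟩ := fun y hy => hg ⟨y, hs hy⟩ hy
      refine ⟨⟨w, fun y hy => ?_⟩, hs, fun z hz => ?_⟩
      · rw [h1 y hy]; exact hw ⟨y, hs hy⟩
      · rw [← e.right_inv hz, h1 _ (e.map_target hz)]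
        exact (g _).2
  · ext y
    simp only [mem_univ, iff_true]
    change (S 0).rel x y
    rw [hS0]; exact y.2
  · ext y
    simp only [mem_iInter, mem_singleton_iff]
    constructor
    · intro hy
      apply Subtype.ext
      refine (A.eq_of_transDist (le_antisymm ?_ zero_le)).symm
      refine ge_of_tendsto (ENNReal.tendsto_pow_atTop_nhds_zero_of_lt_one
        (r := 2⁻¹) (by simp)) ?_
      filter_upwards [Filter.eventually_ge_atTop 1] with l hl
      obtain ⟨m, rfl⟩ := Nat.exists_eq_succ_of_ne_zero (by omega : l ≠ 0)
      exact (hS2 m _ _ (hy m)).le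
    · rintro rfl l
      exact (S l).rel.refl x
  · rw [htrans l]
    refine ((S l).finite_classes.image (fun K => Subtype.val ⁻¹' K)).subset ?_
    rintro _ ⟨y, rfl⟩
    exact ⟨_, ⟨y, rfl⟩, by ext z; exact (S l).rel.comm'⟩
  · rw [htrans l]
    exact Setoid.isPartition_classes _
  · rw [image_class R hR x (S l) hg]
    refine lt_of_le_of_lt (b := (2⁻¹ : ℝ≥0∞) ^ (l + 1)) ?_ ?_
    · refine iSup₂_le fun y hy => iSup₂_le fun z hz => ?_
      obtain ⟨y, hy, rfl⟩ := hy
      obtain ⟨z, hz, rfl⟩ := hz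
      exact (hS2 l _ _ ((S l).rel.trans ((S l).rel.symm hy) hz)).le
    · rw [pow_succ]
      conv_rhs => rw [← mul_one ((2⁻¹ : ℝ≥0∞) ^ l)]
      refine ENNReal.mul_lt_mul_right ?_ ?_ ?_
      · exact pow_ne_zero _ (by simp)
      · exact ENNReal.pow_ne_top (by simp)
      · simp

include H hR h in
/-- A section is strongly quasi-analytic if the isotropy of a point acts trivially. -/
theorem exists_sqa_section (hR2 : ∀ y z, R.rel y z → A.transDist y z < 2⁻¹)
    (hx : ∀ (w : List (Fin A.ν)) (z z' : A.Transversal), A.chainRel w x x → R.rel x z →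
      A.chainRel w z z' → z' = z) :
    ∃ P : TransverseSection A, IsSQA (A.pseudoStarGroupOn P.V₀) ∧ IsSQAAction P.action := by
  obtain ⟨P, hP, hG, hmin⟩ := exists_transverseSection H R hR x h hR2
  -- Minimality gives `k` moving `x` into `U`. Then `k⁻¹ * g * k` fixes `x`, so it is trivial by
  -- `hx`.
  have htriv : ∀ g ∈ P.G₀, ∀ u : P.V₀, ∀ U : Set A.Transversal, IsOpen U → (u : A.Transversal) ∈ U →
      (∀ y : P.V₀, (y : A.Transversal) ∈ U → g y = y) → ∀ y, g y = y := by
    intro g hg u U hU hu hfix y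
    have hxV : x ∈ P.V₀ := hP ▸ R.rel.refl x
    obtain ⟨k, hk, hkU⟩ := hmin U hU ⟨u, hu, u.2⟩ ⟨x, hxV⟩
    have hmem : k⁻¹ * g * k ∈ P.G₀ := mul_mem (mul_mem (inv_mem hk) hg) hk
    obtain ⟨w, hw⟩ := hG _ hmem
    have hfx : (k⁻¹ * g * k) ⟨x, hxV⟩ = ⟨x, hxV⟩ := by
      change k.symm (g (k ⟨x, hxV⟩)) = _
      rw [hfix _ hkU, k.symm_apply_apply]
    have h1 := hw ⟨x, hxV⟩
    rw [hfx] at h1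
    have h2 := Subtype.ext (hx w _ _ h1 (hP.subset (k.symm y).2) (hw (k.symm y)))
    change k.symm (g (k (k.symm y))) = k.symm y at h2
    rw [k.apply_symm_apply] at h2
    exact k.symm.injective h2
  refine ⟨P, ?_, ?_⟩
  · intro e he U hU hne hUs hfix y hy
    obtain ⟨hs, g, hg, hge⟩ := (P.generates e).1 he
    obtain ⟨u, hu⟩ := hne
    have := htriv g hg ⟨u, hs (hUs hu)⟩ U hU hu (fun y hyU => Subtype.ext (by
      rw [← hge y (hUs hyU)]; exact hfix y hyU)) ⟨y, hs hy⟩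
    rw [hge ⟨y, hs hy⟩ hy, this]
  · rintro _ ⟨g, hg, rfl⟩ U hU ⟨u, hu⟩ - hfix y -
    refine htriv g hg u (Subtype.val '' U) (P.isClopen_V₀.isOpen.isOpenMap_subtype_val U hU)
      ⟨u, hu, rfl⟩ (fun y hyU => ?_) y
    obtain ⟨z, hz, hzy⟩ := hyU
    obtain rfl := Subtype.ext hzy
    exact hfix z hz

end Section

end RegularAtlas

namespace RegularAtlas

variable {n : ℕ} {M : Type u} [MetricSpace M] [CompactSpace M] {A : RegularAtlas n M}

/-! ### Invariant relations adapted to a good cover -/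

/-- An invariant relation is adapted to a good cover if its classes are so small that they can be
transported along all plaques. -/
structure IsAdapted (C : GoodCover A) (R : InvariantRel A) : Prop where
  index_eq : ∀ {y y' : A.Transversal}, R.rel y y' → y.1 = y'.1
  step : ∀ {a : Cube n} {y v y' : A.Transversal}, A.param (a, y) ∈ A.plaque v →
      A.param (a, y) ∈ C.O v.1 → R.rel y y' →
      ∃ v' : A.Transversal, v'.1 = v.1 ∧ A.param (a, y') ∈ A.plaque v'
  step_symm : ∀ {q : M} {y v v' : A.Transversal}, q ∈ A.closedPlaque y → q ∈ A.plaque v →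
      q ∈ C.O v.1 → R.rel v v' → ∃ y' : A.Transversal, y'.1 = y.1 ∧ A.Meets v' y'
  agree : ∀ {y z y' z' v z'' : A.Transversal} {q : M}, q ∈ A.closedPlaque y →
      q ∈ A.closedPlaque z → q ∈ C.O v.1 → A.ClosedMeets y' z' → z'.1 = z.1 → R.rel y y' →
      A.Meets y' v → A.Meets v z'' → z''.1 = z.1 → z'' = z'

theorem IsEquicontinuous.exists_isAdapted (h : A.IsEquicontinuous) (C : GoodCover A) :
    ∃ R : InvariantRel A, IsAdapted C R := by
  obtain ⟨δ₁, hδ₁, H1⟩ := C.exists_agreement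
  obtain ⟨δ₂, hδ₂, H2, H3⟩ := C.exists_uniform_step
  obtain ⟨R, hR⟩ := h.exists_invariantRel (lt_min hδ₁ hδ₂)
  have h1 : ∀ {y z}, R.rel y z → A.transDist y z < δ₁ := fun hyz =>
    (hR _ _ hyz).trans_le (min_le_left _ _)
  have h2 : ∀ {y z}, R.rel y z → A.transDist y z < δ₂ := fun hyz =>
    (hR _ _ hyz).trans_le (min_le_right _ _)
  exact ⟨R, fun h => index_eq_of_transDist_lt (h1 h), fun hp hO h => H2 _ _ _ _ hp hO (h2 h),
    fun hy hv hO h => H3 _ _ _ _ hy hv hO (h2 h),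
    fun hy hz hq hm hi hr hv hv' hi' => H1 _ _ _ _ _ _ _ hy hz hq hm hi (h1 hr) hv hv' hi'⟩

open Classical in
/-- The point of the `k`-th local transversal whose plaque meets the plaque of `y`. -/
noncomputable def neighbor (k : Fin A.ν) (y : A.Transversal) : A.Transversal :=
  if h : ∃ z : A.Transversal, z.1 = k ∧ A.Meets y z then h.choose else y

open Classical in
/-- The point of the `k`-th local transversal whose plaque contains `b`. -/
noncomputable def plaqueAt (x : A.Transversal) (k : Fin A.ν) (b : M) : A.Transversal :=
  if h : ∃ z : A.Transversal, z.1 = k ∧ b ∈ A.plaque z then h.choose else x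

omit [CompactSpace M] in
theorem Meets.neighbor_eq {y z : A.Transversal} (h : A.Meets y z) : neighbor z.1 y = z := by
  have h' : ∃ t : A.Transversal, t.1 = z.1 ∧ A.Meets y t := ⟨z, rfl, h⟩
  rw [neighbor, dif_pos h']
  exact h'.choose_spec.2.closed.unique h.closed h'.choose_spec.1

omit [CompactSpace M] in
theorem plaqueAt_eq (x : A.Transversal) {z : A.Transversal} {b : M} (h : b ∈ A.plaque z) :
    plaqueAt x z.1 b = z := by
  have h' : ∃ t : A.Transversal, t.1 = z.1 ∧ b ∈ A.plaque t := ⟨z, rfl, h⟩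
  rw [plaqueAt, dif_pos h']
  exact eq_of_mem_closedPlaque (A.plaque_subset _ h'.choose_spec.2) (A.plaque_subset _ h)
    h'.choose_spec.1

omit [CompactSpace M] in
theorem plaqueAt_spec (x : A.Transversal) {k : Fin A.ν} {b : M} (h : b ∈ A.chartDomain k) :
    (plaqueAt x k b).1 = k ∧ b ∈ A.plaque (plaqueAt x k b) := by
  obtain ⟨z, rfl, hz⟩ := A.mem_chartDomain.1 h
  rw [plaqueAt_eq x hz]
  exact ⟨rfl, hz⟩

theorem continuousOn_plaqueAt (x : A.Transversal) (k : Fin A.ν) :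
    ContinuousOn (plaqueAt x k) (A.chartDomain k) := by
  intro b hb
  obtain ⟨z, rfl, hz⟩ := A.mem_chartDomain.1 hb
  refine ContinuousAt.continuousWithinAt ?_
  intro W hW
  rw [plaqueAt_eq x hz] at hW
  change ∀ᶠ b' in 𝓝 b, plaqueAt x z.1 b' ∈ W
  filter_upwards [eventually_of_mem_plaque hz hW] with b' ⟨y, h1, h2, h3⟩
  rw [← h2, plaqueAt_eq x h3]
  exact h1

section Transport

variable {C : GoodCover A} {R : InvariantRel A} (hA : IsAdapted C R) (x : A.Transversal)

include hA in
omit [CompactSpace M] in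
theorem IsAdapted.neighbor {b : M} {y y' : A.Transversal} {k : Fin A.ν}
    (hb : b ∈ A.closedPlaque y) (hk : b ∈ C.O k) (hy : R.rel y y') :
    A.Meets y' (neighbor k y') ∧ (RegularAtlas.neighbor k y').1 = k ∧
      R.rel (plaqueAt x k b) (RegularAtlas.neighbor k y') := by
  obtain ⟨a, rfl⟩ := A.mem_closedPlaque.1 hb
  obtain ⟨hi, hp⟩ := plaqueAt_spec x (C.subset_chartDomain k hk)
  obtain ⟨v', hv', hm⟩ := hA.step hp (by rwa [hi]) hy
  have h1 : A.Meets y' v' := meets_of_mem (A.param_mem_closedPlaque a y') hm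
  have h2 : RegularAtlas.neighbor k y' = v' := by rw [← hi, ← hv']; exact h1.neighbor_eq
  rw [h2]
  exact ⟨h1, hv'.trans hi, R.invariant_meets (meets_of_mem hb hp) h1 (hA.index_eq hy).symm hv' hy⟩

include hA in
omit [CompactSpace M] in
-- All moves happen at the same cube coordinate `a`, so the three closed plaques involved share a
-- point. This is the cocycle identity of the holonomy covering.
theorem IsAdapted.neighbor_neighbor {b : M} {y y' : A.Transversal} {j k : Fin A.ν}
    (hb : b ∈ A.closedPlaque y) (hj : b ∈ C.O j) (hk : b ∈ C.O k) (hy : R.rel y y') :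
    RegularAtlas.neighbor k (RegularAtlas.neighbor j y') = RegularAtlas.neighbor k y' ∧
      A.Meets (RegularAtlas.neighbor j y') (RegularAtlas.neighbor k y') := by
  obtain ⟨a, rfl⟩ := A.mem_closedPlaque.1 hb
  have key : ∀ i, A.param (a, y) ∈ C.O i →
      (RegularAtlas.neighbor i y').1 = i ∧
      A.param (a, y') ∈ A.plaque (RegularAtlas.neighbor i y') := by
    intro i hi0
    obtain ⟨hi, hp⟩ := plaqueAt_spec y (C.subset_chartDomain i hi0)
    obtain ⟨v', hv', hm⟩ := hA.step hp (by rwa [hi]) hy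
    have h1 : A.Meets y' v' := meets_of_mem (A.param_mem_closedPlaque a y') hm
    have h2 : RegularAtlas.neighbor i y' = v' := by rw [← hi, ← hv']; exact h1.neighbor_eq
    rw [h2]
    exact ⟨hv'.trans hi, hm⟩
  obtain ⟨-, h2⟩ := key j hj
  obtain ⟨h3, h4⟩ := key k hk
  have hm : A.Meets (RegularAtlas.neighbor j y') (RegularAtlas.neighbor k y') := ⟨_, h2, h4⟩
  refine ⟨?_, hm⟩
  conv_lhs => rw [← h3]
  exact hm.neighbor_eq

end Transport

/-! ### A common model fibre for all classes -/

/-- Simultaneous coordinates, with values in a fixed type, on the classes of an invariant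
relation. -/
structure ClassCoords (R : InvariantRel A) (F : Type u) where
  /-- the inverses of the coordinates of a class -/
  param : A.Transversal → F → A.Transversal
  /-- the coordinates of a class -/
  coord : A.Transversal → A.Transversal → F
  rel_param : ∀ y f, R.rel y (param y f)
  coord_param : ∀ y f, coord y (param y f) = f
  param_coord : ∀ {y y'}, R.rel y y' → param y (coord y y') = y'
  param_congr : ∀ {y y'}, R.rel y y' → param y = param y'
  coord_congr : ∀ {y y'}, R.rel y y' → coord y = coord y'

/-- By minimality a word leads from `x` into the class of `y`, and its extension is injective on the
class of `x`. Embeddings in both directions make the classes equinumerous. -/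
theorem exists_embedding_class [ConnectedSpace M] (h : A.IsEquicontinuous) {δ : ℝ≥0∞}
    (H : IsExtensionRadius A δ) (R : InvariantRel A)
    (hR : ∀ y z, R.rel y z → A.transDist y z < δ) (x y : A.Transversal) :
    Nonempty ({z | R.rel x z} ↪ {z | R.rel y z}) := by
  obtain ⟨w, z, hw, hz⟩ := h.exists_chainRel_mem (R.isOpen_class y) ⟨y, R.rel.refl y⟩ x
  obtain ⟨w', hw'⟩ := H w x z hw
  have hdef : ∀ t, R.rel x t → A.chainRel w' t (wordFun w' t) := fun t ht =>
    chainRel_wordFun ((hw' t (hR x t ht)).imp fun _ h => h.1)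
  have hz' : A.chainRel w' x z := by
    obtain ⟨s, hs, hs2⟩ := hw' x (hR x x (R.rel.refl x))
    exact (hs2 z hw) ▸ hs
  refine ⟨⟨fun t => ⟨wordFun w' t, R.rel.trans hz (R.invariant hz' (hdef t t.2) t.2)⟩,
    fun s t hst => Subtype.ext ?_⟩⟩
  have := hdef s s.2
  rw [show wordFun w' (s : A.Transversal) = wordFun w' t from congrArg Subtype.val hst] at this
  exact chainRel_injective this (hdef t t.2)

theorem exists_classCoords [ConnectedSpace M] (h : A.IsEquicontinuous) {δ : ℝ≥0∞}
    (H : IsExtensionRadius A δ) (R : InvariantRel A)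
    (hR : ∀ y z, R.rel y z → A.transDist y z < δ) (x : A.Transversal) :
    Nonempty (Σ F : Type u, ClassCoords R F) := by
  classical
  have he : ∀ y, Nonempty ({z | R.rel x z} ≃ {z | R.rel y z}) := fun y =>
    Function.Embedding.antisymm (exists_embedding_class h H R hR x y).some
      (exists_embedding_class h H R hR y x).some
  let e := fun y => (he y).some
  -- Coordinates are attached to a chosen representative, so that they depend only on the class.
  let ρ : A.Transversal → A.Transversal := fun y => (Quotient.mk R.rel y).out
  have hρ : ∀ y, R.rel (ρ y) y := fun y => Quotient.exact (Quotient.out_eq _)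
  have hρ2 : ∀ {y y'}, R.rel y y' → ρ y = ρ y' := fun hy => by
    simp only [ρ]; rw [Quotient.sound hy]
  refine ⟨⟨{z | R.rel x z}, fun y f => e (ρ y) f,
    fun y y' => if hy : R.rel (ρ y) y' then (e (ρ y)).symm ⟨y', hy⟩ else ⟨x, R.rel.refl x⟩,
    fun y f => R.rel.trans (R.rel.symm (hρ y)) (e (ρ y) f).2, fun y f => ?_, fun {y y'} hy => ?_,
    fun {y y'} hy => ?_, fun {y y'} hy => ?_⟩⟩
  · rw [dif_pos (show R.rel (ρ y) (e (ρ y) f) from (e (ρ y) f).2)]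
    simp
  · rw [dif_pos (R.rel.trans (hρ y) hy)]
    simp
  · rw [hρ2 hy]
  · rw [hρ2 hy]

end RegularAtlas

namespace RegularAtlas

variable {n : ℕ} {M : Type u} [MetricSpace M] [CompactSpace M] {A : RegularAtlas n M}

/-! ### The holonomy covering -/

section Covering

variable {C : GoodCover A} {R : InvariantRel A} (hA : IsAdapted C R) (x : A.Transversal)
  {F : Type u} (T : ClassCoords R F)

include hA in
omit [CompactSpace M] in
theorem IsAdapted.neighbor_param {b : M} {i k : Fin A.ν} (hi : b ∈ C.O i) (hk : b ∈ C.O k)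
    (f : F) :
    A.Meets (T.param (plaqueAt x i b) f)
      (RegularAtlas.neighbor k (T.param (plaqueAt x i b) f)) ∧
    R.rel (plaqueAt x k b) (RegularAtlas.neighbor k (T.param (plaqueAt x i b) f)) := by
  have hp := (plaqueAt_spec x (C.subset_chartDomain i hi)).2
  obtain ⟨h1, -, h2⟩ := hA.neighbor x (A.plaque_subset _ hp) hk (T.rel_param _ f)
  exact ⟨h1, h2⟩

theorem eventually_rel_plaqueAt {b : M} {k : Fin A.ν} (hk : b ∈ C.O k) :
    ∀ᶠ b' in 𝓝 b, R.rel (plaqueAt x k b) (plaqueAt x k b') :=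
  ((continuousOn_plaqueAt x k).continuousAt ((A.isOpen_chartDomain k).mem_nhds
    (C.subset_chartDomain k hk))).eventually_mem (R.eventually_rel (plaqueAt x k b))

variable [TopologicalSpace F] [DiscreteTopology F]

/-- The holonomy covering of `M`: its fibre over a point of a plaque consists of the points of the
class of that plaque, and the points of the classes are identified along the leaves. -/
noncomputable def holonomyCore : FiberBundleCore (Fin A.ν) M F where
  baseSet := C.O
  isOpen_baseSet := C.isOpen_O
  indexAt b := (C.cover b).choose
  mem_baseSet_at b := (C.cover b).choose_spec
  coordChange i j b f := T.coord (plaqueAt x j b) (neighbor j (T.param (plaqueAt x i b) f))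
  coordChange_self i b hb f := by
    have hi := (plaqueAt_spec x (C.subset_chartDomain i hb)).1
    have h1 : (T.param (plaqueAt x i b) f).1 = i :=
      (hA.index_eq (T.rel_param _ f)).symm.trans hi
    have h2 := (meets_self (T.param (plaqueAt x i b) f)).neighbor_eq
    rw [h1] at h2
    rw [h2, T.coord_param]
  continuousOn_coordChange i j := by
    rintro ⟨b, f⟩ ⟨⟨hi, hj⟩, -⟩
    refine ContinuousAt.continuousWithinAt ?_
    refine Filter.Tendsto.mono_right ?_ (pure_le_nhds _)
    refine Filter.tendsto_pure.2 ?_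
    have h1 : ∀ᶠ p in 𝓝 (b, f), p.2 = f :=
      continuous_snd.continuousAt.eventually_mem ((isOpen_discrete ({f} : Set F)).mem_nhds (mem_singleton f))
    -- Near `b` neither the class in chart `i` nor that in chart `j` changes, so the coordinate
    -- change is locally constant.
    filter_upwards [h1, continuous_fst.continuousAt.eventually (eventually_rel_plaqueAt x hi),
      continuous_fst.continuousAt.eventually (eventually_rel_plaqueAt x hj)] with p h2 h3 h4
    rw [h2, ← T.param_congr h3, ← T.coord_congr h4]
  coordChange_comp := by
    rintro i j k b ⟨⟨hi, hj⟩, hk⟩ f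
    rw [T.param_coord (hA.neighbor_param x T hi hj f).2]
    have hp := (plaqueAt_spec x (C.subset_chartDomain i hi)).2
    rw [(hA.neighbor_neighbor (A.plaque_subset _ hp) hj hk (T.rel_param _ f)).1]

/-- The projection of the holonomy covering. -/
theorem isCoveringMap_holonomyCore : IsCoveringMap (holonomyCore hA x T).proj :=
  FiberBundle.isCoveringMap

/-- The position, in the `k`-th local transversal, of a point of the holonomy covering. -/
noncomputable def position (k : Fin A.ν) (e : (holonomyCore hA x T).TotalSpace) :
    A.Transversal :=
  T.param (plaqueAt x k e.1) (((holonomyCore hA x T).localTriv k e).2)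

/-- The point of the holonomy covering over `b` with transverse coordinate `y`. -/
noncomputable def coverPoint (b : M) (y : A.Transversal) :
    (holonomyCore hA x T).proj ⁻¹' {b} :=
  ⟨⟨b, T.coord (plaqueAt x (C.cover b).choose b) (neighbor (C.cover b).choose y)⟩, rfl⟩

theorem rel_position {k : Fin A.ν} (e : (holonomyCore hA x T).TotalSpace) :
    R.rel (plaqueAt x k e.1) (position hA x T k e) := T.rel_param _ _

theorem position_eq {k : Fin A.ν} (e : (holonomyCore hA x T).TotalSpace) (hk : e.1 ∈ C.O k) :
    position hA x T k e =
      neighbor k (T.param (plaqueAt x (C.cover e.1).choose e.1) e.2) :=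
  T.param_coord (hA.neighbor_param x T (C.cover e.1).choose_spec hk e.2).2

theorem position_neighbor {k l : Fin A.ν} (e : (holonomyCore hA x T).TotalSpace)
    (hk : e.1 ∈ C.O k) (hl : e.1 ∈ C.O l) :
    A.Meets (position hA x T k e) (position hA x T l e) := by
  rw [position_eq hA x T e hk, position_eq hA x T e hl]
  have hp := (plaqueAt_spec x (C.subset_chartDomain _ (C.cover e.1).choose_spec)).2
  exact (hA.neighbor_neighbor (A.plaque_subset _ hp) hk hl (T.rel_param _ _)).2

theorem position_index {k : Fin A.ν} (e : (holonomyCore hA x T).TotalSpace)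
    (hk : e.1 ∈ C.O k) : (position hA x T k e).1 = k :=
  (hA.index_eq (rel_position hA x T e)).symm.trans
    (plaqueAt_spec x (C.subset_chartDomain k hk)).1

theorem position_coverPoint {b : M} {y y' : A.Transversal} {k : Fin A.ν}
    (hb : b ∈ A.closedPlaque y) (hy : R.rel y y') (hk : b ∈ C.O k) :
    position hA x T k (coverPoint hA x T b y') = neighbor k y' := by
  rw [position_eq hA x T _ hk]
  change neighbor k (T.param (plaqueAt x (C.cover b).choose b)
    (T.coord (plaqueAt x (C.cover b).choose b) (neighbor (C.cover b).choose y'))) = _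
  rw [T.param_coord (hA.neighbor x hb (C.cover b).choose_spec hy).2.2]
  exact (hA.neighbor_neighbor hb (C.cover b).choose_spec hk hy).1

/-- A point of the holonomy covering is determined by its positions. -/
theorem eq_coverPoint {b : M} {y y' : A.Transversal} {k : Fin A.ν} (hb : b ∈ A.closedPlaque y)
    (hy : R.rel y y') (e : (holonomyCore hA x T).proj ⁻¹' {b}) (hk : b ∈ C.O k)
    (h : position hA x T k e = neighbor k y') : e = coverPoint hA x T b y' := by
  obtain ⟨⟨b', f⟩, rfl⟩ := e
  apply Subtype.ext
  change (⟨b', f⟩ : (holonomyCore hA x T).TotalSpace) = ⟨b', _⟩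
  congr 1
  change f = T.coord (plaqueAt x (C.cover b').choose b') (neighbor (C.cover b').choose y')
  have hk0 : b' ∈ C.O (C.cover b').choose := (C.cover b').choose_spec
  have h1 := (position_neighbor hA x T ⟨b', f⟩ hk hk0).neighbor_eq
  rw [position_index hA x T ⟨b', f⟩ hk0, h, (hA.neighbor_neighbor hb hk hk0 hy).1] at h1
  rw [h1]
  have h2 : position hA x T (C.cover b').choose ⟨b', f⟩ =
      T.param (plaqueAt x (C.cover b').choose b') f := by
    change T.param _ ((holonomyCore hA x T).coordChange _ _ b' f) = _
    congr 1
    exact (holonomyCore hA x T).coordChange_self _ b' hk0 f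
  rw [h2]
  exact (T.coord_param _ _).symm

theorem coverPoint_injective {b : M} {y y₁ y₂ : A.Transversal} (hb : b ∈ A.closedPlaque y)
    (h₁ : R.rel y y₁) (h₂ : R.rel y y₂) (h : coverPoint hA x T b y₁ = coverPoint hA x T b y₂) :
    y₁ = y₂ := by
  have hk := (C.cover b).choose_spec
  have e1 := position_coverPoint hA x T hb h₁ hk
  rw [h, position_coverPoint hA x T hb h₂ hk] at e1
  have m1 := (hA.neighbor x hb hk h₁).1
  have m2 := (hA.neighbor x hb hk h₂).1
  rw [e1] at m2
  exact m1.symm.closed.unique m2.symm.closed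
    ((hA.index_eq h₁).symm.trans (hA.index_eq h₂))

/-- Curves in a closed plaque lift to the holonomy covering with constant coordinates. -/
theorem continuous_coverPoint {Z : Type*} [TopologicalSpace Z] {a : Z → Cube n}
    (ha : Continuous a) {y y' : A.Transversal} (hy : R.rel y y') :
    Continuous fun t => (coverPoint hA x T (A.param (a t, y)) y' :
      (holonomyCore hA x T).TotalSpace) := by
  have hc : Continuous fun t => A.param (a t, y) :=
    A.continuous_param.comp (ha.prodMk continuous_const)
  refine continuous_iff_continuousAt.2 fun t₀ => ?_
  rw [FiberBundle.continuousAt_totalSpace]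
  refine ⟨hc.continuousAt, ?_⟩
  refine Filter.Tendsto.mono_right ?_ (pure_le_nhds _)
  refine Filter.tendsto_pure.2 ?_
  set k := (C.cover (A.param (a t₀, y))).choose with hk
  have hk0 : A.param (a t₀, y) ∈ C.O k := (C.cover (A.param (a t₀, y))).choose_spec
  have key : ∀ t, A.param (a t, y) ∈ C.O k →
      ((holonomyCore hA x T).localTriv k (coverPoint hA x T (A.param (a t, y)) y')).2 =
      T.coord (neighbor k y) (neighbor k y') := by
    intro t ht
    have h1 := position_coverPoint hA x T (A.param_mem_closedPlaque (a t) y) hy ht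
    obtain ⟨hi, hp⟩ := plaqueAt_spec x (C.subset_chartDomain k ht)
    have h2 := (meets_of_mem (A.param_mem_closedPlaque (a t) y) hp).neighbor_eq
    rw [hi] at h2
    rw [← h1, h2]
    exact (T.coord_param _ _).symm
  filter_upwards [hc.continuousAt.eventually_mem ((C.isOpen_O k).mem_nhds hk0)] with t ht
  exact (key t ht).trans (key t₀ hk0).symm

/-- `continuous_coverPoint` is a lift with constant coordinate `y'`, and lifts are unique. -/
theorem monodromy_coverPoint {a₀ a₁ : Cube n} (a : Path a₀ a₁) {y y' : A.Transversal}
    (hy : R.rel y y') {p q : M} (hp : p = A.param (a₀, y)) (hq : q = A.param (a₁, y))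
    (γ : Path p q) (hγ : ∀ t, γ t = A.param (a t, y)) :
    (isCoveringMap_holonomyCore hA x T).monodromy (Path.Homotopic.Quotient.mk γ)
      (coverPoint hA x T p y') = coverPoint hA x T q y' := by
  subst hp hq
  have cov := isCoveringMap_holonomyCore hA x T
  apply Subtype.ext
  have h0 : γ 0 = (holonomyCore hA x T).proj (coverPoint hA x T (A.param (a₀, y)) y') :=
    γ.source
  change cov.liftPath γ _ h0 1 = _
  have := (cov.eq_liftPath_iff' h0 (Γ := ⟨_, continuous_coverPoint hA x T a.continuous hy⟩)).2
    ⟨by ext t; exact (hγ t).symm, by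
      change (coverPoint hA x T (A.param (a 0, y)) y' : (holonomyCore hA x T).TotalSpace) = _
      rw [a.source]⟩
  refine (congrArg (fun Γ : C(unitInterval, _) => Γ 1) this).symm.trans ?_
  change (coverPoint hA x T (A.param (a 1, y)) y' : (holonomyCore hA x T).TotalSpace) = _
  rw [a.target]

end Covering

end RegularAtlas

namespace RegularAtlas

variable {n : ℕ} {M : Type u} [MetricSpace M] [CompactSpace M] {A : RegularAtlas n M}

/-! ### Holonomy along loops -/

/-- The segment from the centre to a point of the cube. -/
def cubeSegment (a : Cube n) : Path (cubeCenter n) a where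
  toFun t := cubeScale t a
  continuous_toFun := continuous_cubeScale.comp (continuous_id.prodMk continuous_const)
  source' := cubeScale_zero a
  target' := cubeScale_one a

section Covering

variable {C : GoodCover A} {R : InvariantRel A} (hA : IsAdapted C R) (x : A.Transversal)
  {F : Type u} (T : ClassCoords R F) [TopologicalSpace F] [DiscreteTopology F]

/-- The holonomy along a word is the monodromy of the holonomy covering along some path. -/
theorem exists_path_of_chainRel : ∀ {w : List (Fin A.ν)} {y z : A.Transversal},
    A.chainRel w y z → ∃ γ : Path (A.emb y) (A.emb z), ∀ y', R.rel y y' → ∃ z', R.rel z z' ∧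
      (isCoveringMap_holonomyCore hA x T).monodromy (Path.Homotopic.Quotient.mk γ)
        (coverPoint hA x T (A.emb y) y') = coverPoint hA x T (A.emb z) z' ∧
      ∀ z'', A.chainRel w y' z'' → z'' = z'
  | [], _, _, h => h.elim
  | [i], y, z, h => by
    obtain ⟨rfl, rfl⟩ := h
    refine ⟨Path.refl _, fun y' hy' => ⟨y', hy', ?_, fun z'' h => h.2.symm⟩⟩
    exact congrFun (isCoveringMap_holonomyCore hA x T).monodromy_refl _
  | i :: j :: w, y, z, ⟨h0, y₁, ⟨q, hq, hq₁⟩, hw⟩ => by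
    obtain ⟨γ, hγ⟩ := exists_path_of_chainRel hw
    have hj : y₁.1 = j := chainRel_head hw
    obtain ⟨a, ha, hay⟩ := A.mem_plaque.1 hq
    obtain ⟨b, hb, hby⟩ := A.mem_plaque.1 hq₁
    have hc : ∀ y, Continuous fun a => A.param (a, y) := fun y =>
      A.continuous_param.comp (continuous_id.prodMk continuous_const)
    -- The path runs from the centre of the plaque of `y` to the common point `q`, then to the
    -- centre of the plaque of `y₁`.
    let γ₁ : Path (A.emb y) q := ((cubeSegment a).map (hc y)).cast rfl hay.symm
    let γ₂ : Path q (A.emb y₁) := ((cubeSegment b).symm.map (hc y₁)).cast hby.symm rfl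
    refine ⟨(γ₁.trans γ₂).trans γ, fun y' hy' => ?_⟩
    set k := (C.cover q).choose with hk
    have hkq : q ∈ C.O k := (C.cover q).choose_spec
    obtain ⟨hi, hp⟩ := plaqueAt_spec x (C.subset_chartDomain k hkq)
    obtain ⟨m1, m2, m3⟩ := hA.neighbor x (A.plaque_subset _ hq) hkq hy'
    obtain ⟨y₁', e1, m4⟩ := hA.step_symm (A.plaque_subset _ hq₁) hp (by rwa [hi]) m3
    have hr : R.rel y₁ y₁' := R.invariant_meets ⟨q, hp, hq₁⟩ m4 (m2.trans hi.symm) e1 m3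
    obtain ⟨z', hz', hmon, hag⟩ := hγ y₁' hr
    refine ⟨z', hz', ?_, ?_⟩
    · rw [Path.Homotopic.Quotient.mk_trans, IsCoveringMap.monodromy_trans_apply,
        Path.Homotopic.Quotient.mk_trans, IsCoveringMap.monodromy_trans_apply,
        monodromy_coverPoint hA x T (cubeSegment a) hy' (A.emb_eq y) hay.symm γ₁ (fun t => rfl)]
      -- Over `q` the coordinate may be switched from `y'` to `y₁'`, as both have the same position
      -- in chart `k`.
      have e2 : coverPoint hA x T q y' = coverPoint hA x T q y₁' := by
        refine eq_coverPoint hA x T (A.plaque_subset _ hq₁) hr _ hkq ?_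
        rw [position_coverPoint hA x T (A.plaque_subset _ hq) hy' hkq]
        have := m4.symm.neighbor_eq
        rw [m2] at this
        exact this.symm
      rw [e2, monodromy_coverPoint hA x T (cubeSegment b).symm hr hby.symm (A.emb_eq y₁) γ₂
        (fun t => rfl)]
      exact hmon
    · rintro z'' ⟨-, t, ht, htw⟩
      have ht : A.Meets y' t := ht
      have e2 : y₁' = t := hA.agree (A.plaque_subset _ hq) (A.plaque_subset _ hq₁)
        (by rwa [m2]) ht.closed ((chainRel_head htw).trans hj.symm) hy' m1 m4 e1
      exact hag z'' (e2 ▸ htw)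

/-- The monodromy of the holonomy covering along a loop is the holonomy along some word. -/
theorem exists_word_of_loop (γ : Path (A.emb x) (A.emb x)) :
    ∃ w : List (Fin A.ν), A.chainRel w x x ∧ ∀ z, R.rel x z → ∃ z', A.chainRel w z z' ∧
      (isCoveringMap_holonomyCore hA x T).monodromy (Path.Homotopic.Quotient.mk γ)
        (coverPoint hA x T (A.emb x) z) = coverPoint hA x T (A.emb x) z' := by
  have cov := isCoveringMap_holonomyCore hA x T
  have h0 : ∀ z, γ 0 = (holonomyCore hA x T).proj (coverPoint hA x T (A.emb x) z) :=
    fun z => γ.source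
  let Γ := fun z => cov.liftPath γ _ (h0 z)
  have hΓ : ∀ z t, (Γ z t).1 = γ t := fun z t => congrFun (cov.liftPath_lifts γ _ (h0 z)) t
  have hΓ0 : ∀ z, Γ z 0 = coverPoint hA x T (A.emb x) z := fun z => cov.liftPath_zero γ _ (h0 z)
  -- One word must describe, up to time `t`, both the motion of the loop and that of all its lifts.
  let Q : unitInterval → Prop := fun t => ∀ k, γ t ∈ C.O k → ∃ w : List (Fin A.ν),
    A.chainRel w x (plaqueAt x k (γ t)) ∧
      ∀ z, R.rel x z → A.chainRel w z (position hA x T k (Γ z t))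
  have hseg : ∀ (J : Set unitInterval) (k : Fin A.ν), IsPreconnected J →
      (∀ t ∈ J, γ t ∈ C.O k) → ∀ t ∈ J, ∀ t' ∈ J, Q t → Q t' := by
    intro J k hJ hJk t ht t' ht' hQ l hl
    obtain ⟨w, hw1, hw2⟩ := hQ k (hJk t ht)
    -- The transversal is totally disconnected, so a connected stretch inside one chart stays on one
    -- plaque. The lifts keep their position because `F` is discrete.
    have e1 : plaqueAt x k (γ t) = plaqueAt x k (γ t') := by
      have hc : ContinuousOn (fun s => plaqueAt x k (γ s)) J :=
        (continuousOn_plaqueAt x k).comp γ.continuous.continuousOn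
          (fun s hs => C.subset_chartDomain k (hJk s hs))
      exact (hJ.image _ hc).subsingleton (mem_image_of_mem _ ht) (mem_image_of_mem _ ht')
    have e2 : ∀ z, position hA x T k (Γ z t) = position hA x T k (Γ z t') := by
      intro z
      have hc : ContinuousOn (fun s => ((holonomyCore hA x T).localTriv k (Γ z s)).2) J := by
        refine continuous_snd.comp_continuousOn
          (((holonomyCore hA x T).localTriv k).continuousOn.comp (Γ z).continuous.continuousOn ?_)
        intro s hs
        change (Γ z s).1 ∈ C.O k
        rw [hΓ]
        exact hJk s hs
      unfold position
      rw [hΓ, hΓ, e1]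
      exact congrArg _ (hJ.constant hc ht ht')
    obtain ⟨i1, p1⟩ := plaqueAt_spec x (C.subset_chartDomain k (hJk t' ht'))
    obtain ⟨i2, p2⟩ := plaqueAt_spec x (C.subset_chartDomain l hl)
    refine ⟨w ++ [l], ?_, fun z hz => ?_⟩
    · have := chainRel_snoc (e1 ▸ hw1) ⟨_, p1, p2⟩
      rwa [i2] at this
    · have hk' : (Γ z t').1 ∈ C.O k := by rw [hΓ]; exact hJk t' ht'
      have hl' : (Γ z t').1 ∈ C.O l := by rw [hΓ]; exact hl
      have := chainRel_snoc (e2 z ▸ hw2 z hz) (position_neighbor hA x T (Γ z t') hk' hl')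
      rwa [position_index hA x T _ hl'] at this
  have hembx : A.emb x ∈ A.closedPlaque x := A.plaque_subset _ (A.emb_mem_plaque x)
  have hQ0 : Q 0 := by
    intro k hk
    rw [γ.source] at hk ⊢
    obtain ⟨hi, hp⟩ := plaqueAt_spec x (C.subset_chartDomain k hk)
    refine ⟨[x.1, k], ⟨rfl, _, ⟨A.emb x, A.emb_mem_plaque x, hp⟩, hi, rfl⟩, fun z hz => ?_⟩
    rw [hΓ0, position_coverPoint hA x T hembx hz hk]
    obtain ⟨h1, h2, -⟩ := hA.neighbor x hembx hk hz
    exact ⟨(hA.index_eq hz).symm, _, h1, h2, rfl⟩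
  have hQ1 : Q 1 := by
    obtain ⟨t, ht0, htm, ⟨N, hN⟩, ht⟩ := exists_monotone_Icc_subset_open_cover_unitInterval
      (c := fun k => γ ⁻¹' (C.O k)) (fun k => (C.isOpen_O k).preimage γ.continuous)
      (fun s _ => mem_iUnion.2 (C.cover (γ s)))
    have hQ : ∀ m, Q (t m) := by
      intro m
      induction m with
      | zero => rw [ht0]; exact hQ0
      | succ m ih =>
        obtain ⟨k, hk⟩ := ht m
        exact hseg (Icc (t m) (t (m + 1))) k isPreconnected_Icc (fun s hs => hk hs) (t m)
          (left_mem_Icc.2 (htm m.le_succ)) (t (m + 1)) (right_mem_Icc.2 (htm m.le_succ)) ih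
    exact hN N le_rfl ▸ hQ N
  obtain ⟨w, hw1, hw2⟩ := hQ1 x.1 (by rw [γ.target]; exact C.emb_mem x)
  have e0 : plaqueAt x x.1 (γ 1) = x := by
    rw [γ.target]; exact plaqueAt_eq x (A.emb_mem_plaque x)
  rw [e0] at hw1
  refine ⟨w, hw1, fun z hz => ⟨_, hw2 z hz, ?_⟩⟩
  have hr := rel_position hA x T (k := x.1) (Γ z 1)
  rw [hΓ, e0] at hr
  have e3 := (meets_self (position hA x T x.1 (Γ z 1))).neighbor_eq
  rw [← hA.index_eq hr] at e3
  exact eq_coverPoint hA x T hembx hr ⟨Γ z 1, (hΓ z 1).trans γ.target⟩ (C.emb_mem x) e3.symm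

end Covering

/-! ### Finite `π₁`-type, trivial isotropy and the first assertion -/

/-- In `hx` the neighbourhood depends on the word; in the conclusion it does not. The loops whose
monodromy fixes the point with coordinate `z` form a subgroup, so it suffices to treat finitely many
generators, each of which acts as a word. -/
theorem exists_trivial_isotropy [ConnectedSpace M] (h : A.IsEquicontinuous)
    (hfin : LeavesFinitePiOneType M) (x : A.Transversal)
    (hx : ∀ w : List (Fin A.ν), A.chainRel w x x →
      ∀ᶠ z in 𝓝 x, ∀ z', A.chainRel w z z' → z' = z) :
    ∀ᶠ z in 𝓝 x, ∀ (w : List (Fin A.ν)) (z' : A.Transversal), A.chainRel w x x →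
      A.chainRel w z z' → z' = z := by
  obtain ⟨C⟩ := A.exists_goodCover
  obtain ⟨R₁, hA₁⟩ := h.exists_isAdapted C
  obtain ⟨δ, hδ, H⟩ := h.exists_extension
  obtain ⟨R₂, hR₂⟩ := h.exists_invariantRel hδ
  let R := R₁.inf R₂
  have hA : IsAdapted C R :=
    ⟨fun h => hA₁.index_eq h.1, fun h1 h2 h3 => hA₁.step h1 h2 h3.1,
      fun h1 h2 h3 h4 => hA₁.step_symm h1 h2 h3 h4.1,
      fun h1 h2 h3 h4 h5 h6 h7 h8 h9 => hA₁.agree h1 h2 h3 h4 h5 h6.1 h7 h8 h9⟩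
  obtain ⟨⟨F, T⟩⟩ := exists_classCoords h H R (fun y z hyz => hR₂ y z hyz.2) x
  let _ : TopologicalSpace F := ⊥
  have _ : DiscreteTopology F := ⟨rfl⟩
  have cov := isCoveringMap_holonomyCore hA x T
  let p : pathComponent (A.emb x) := ⟨A.emb x, mem_pathComponent_self _⟩
  have hpc : PathConnectedSpace (pathComponent (A.emb x)) :=
    isPathConnected_iff_pathConnectedSpace.1 isPathConnected_pathComponent
  have hfg : Group.FG (FundamentalGroup (pathComponent (A.emb x)) p) := by
    obtain ⟨p', hp'⟩ := hfin (A.emb x)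
    exact Group.fg_of_surjective
      (f := (FundamentalGroup.fundamentalGroupMulEquivOfPathConnected p' p).toMonoidHom)
      (FundamentalGroup.fundamentalGroupMulEquivOfPathConnected p' p).surjective
  obtain ⟨S, hS, hSfin⟩ := Group.fg_iff.1 hfg
  let incl : C(pathComponent (A.emb x), M) := ⟨Subtype.val, continuous_subtype_val⟩
  let φ : FundamentalGroup (pathComponent (A.emb x)) p →*
      Equiv.Perm ((holonomyCore hA x T).proj ⁻¹' {A.emb x}) :=
    (cov.monodromyPerm (A.emb x)).comp (FundamentalGroup.map incl p)
  have hφ : ∀ γ : Path p p, φ (Path.Homotopic.Quotient.mk γ) =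
      cov.monodromy (Path.Homotopic.Quotient.mk (γ.map incl.continuous)) := fun γ => rfl
  have hgen : ∀ g ∈ S, ∀ᶠ z in 𝓝 x, R.rel x z →
      φ g (coverPoint hA x T (A.emb x) z) = coverPoint hA x T (A.emb x) z := by
    intro g _
    obtain ⟨γ, rfl⟩ := Path.Homotopic.Quotient.mk_surjective g
    obtain ⟨w, hw, hw2⟩ := exists_word_of_loop hA x T (γ.map incl.continuous)
    filter_upwards [hx w hw] with z hz hxz
    obtain ⟨z', h1, h2⟩ := hw2 z hxz
    rw [hφ, h2, hz z' h1]
  filter_upwards [(Filter.eventually_all_finite hSfin).2 hgen, R.eventually_rel x] with z hz hxz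
    w z' hw hz'
  have htop : (⊤ : Subgroup (FundamentalGroup (pathComponent (A.emb x)) p)) ≤
      (MulAction.stabilizer _ (coverPoint hA x T (A.emb x) z)).comap φ := by
    rw [← hS, Subgroup.closure_le]
    intro g hg
    exact hz g hg hxz
  obtain ⟨γ, hγ⟩ := exists_path_of_chainRel hA x T hw
  obtain ⟨z'', hr, hmon, hag⟩ := hγ z hxz
  -- The path realizing `w` lies in the leaf, hence is a loop there, and `htop` applies to it.
  have hmem : ∀ t, γ t ∈ pathComponent (A.emb x) := fun t =>
    ⟨(γ.truncateOfLE (t₀ := 0) (t₁ := t) t.2.1).cast (by simp) (by simp)⟩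
  let γ' : Path p p :=
    ⟨⟨fun t => ⟨γ t, hmem t⟩, γ.continuous.subtype_mk _⟩, Subtype.ext γ.source,
      Subtype.ext γ.target⟩
  have h1 : φ (Path.Homotopic.Quotient.mk γ') (coverPoint hA x T (A.emb x) z) =
      coverPoint hA x T (A.emb x) z := htop (Subgroup.mem_top _)
  rw [hφ] at h1
  have h2 : γ'.map incl.continuous = γ := by ext t; rfl
  have h3 : coverPoint hA x T (A.emb x) z = coverPoint hA x T (A.emb x) z'' := by
    rw [← hmon, ← h1]
    exact congrArg (fun q => cov.monodromy q _) (congrArg _ h2) |>.trans (by rw [h1])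
  have h4 := coverPoint_injective hA x T (A.plaque_subset _ (A.emb_mem_plaque x)) hxz hr h3
  rw [hag z' hz', h4]

/-- Some point has trivial germinal holonomy. -/
theorem exists_trivial_germs [Nonempty A.Transversal] :
    ∃ x : A.Transversal, ∀ w : List (Fin A.ν), A.chainRel w x x →
      ∀ᶠ z in 𝓝 x, ∀ z', A.chainRel w z z' → z' = z := by
  -- The fixed points of `w` at which its germ is nontrivial. The fixed set is closed in the open
  -- domain of `w`, so `B w` is nowhere dense, and there are only countably many words.
  let B : List (Fin A.ν) → Set A.Transversal := fun w =>
    {y | A.chainRel w y y} \ interior {y | A.chainRel w y y}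
  have hB : ∀ w, IsNowhereDense (B w) := by
    intro w
    rw [IsNowhereDense, ← not_nonempty_iff_eq_empty]
    rintro ⟨y₀, hy₀⟩
    obtain ⟨y, hyo, hyB⟩ := mem_closure_iff.1 (interior_subset hy₀) _ isOpen_interior hy₀
    refine hyB.2 ?_
    rw [mem_interior_iff_mem_nhds]
    filter_upwards [isOpen_interior.mem_nhds hyo,
      (isOpen_chainRel_dom w).mem_nhds ⟨y, hyB.1⟩] with z hz ⟨z', hz'⟩
    by_cases hzz : z' = z
    · exact hzz ▸ hz'
    · exfalso
      obtain ⟨U, V, hU, hV, hUz, hVz, hd⟩ := t2_separation hzz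
      obtain ⟨s, ⟨hsV, s', hs', hs⟩, hsB⟩ := mem_closure_iff_nhds.1 (interior_subset hz) _
        (Filter.inter_mem (hV.mem_nhds hVz) (chainRel_eventually hz' (hU.mem_nhds hUz)))
      rw [chainRel_unique hs hsB.1] at hs'
      exact hd.le_bot ⟨hs', hsV⟩
  have hmeagre : IsMeagre (⋃ w, B w) := isMeagre_iUnion fun w => (hB w).isMeagre
  obtain ⟨x, hx⟩ := (dense_of_mem_residual hmeagre).nonempty
  refine ⟨x, fun w hw => ?_⟩
  have : x ∈ interior {y | A.chainRel w y y} := by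
    by_contra hc
    exact hx (mem_iUnion.2 ⟨w, hw, hc⟩)
  filter_upwards [mem_interior_iff_mem_nhds.1 this] with z hz z' hz'
  exact chainRel_unique hz' hz

theorem exists_sqa_transverseSection [ConnectedSpace M] (h : A.IsEquicontinuous)
    (hfin : LeavesFinitePiOneType M) :
    ∃ P : TransverseSection A, IsSQA (A.pseudoStarGroupOn P.V₀) ∧ IsSQAAction P.action := by
  have : Nonempty A.Transversal := by
    obtain ⟨p⟩ := (inferInstance : Nonempty M)
    obtain ⟨i, hi⟩ := A.cover p
    obtain ⟨y, -, -⟩ := A.mem_chartDomain.1 hi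
    exact ⟨y⟩
  obtain ⟨x, hx⟩ := exists_trivial_germs (A := A)
  obtain ⟨ε, hε, hO⟩ := A.exists_transDist_ball (exists_trivial_isotropy h hfin x hx)
  obtain ⟨δ, hδ, H⟩ := h.exists_extension
  obtain ⟨R, hR⟩ := h.exists_invariantRel (lt_min (lt_min hε hδ)
    (show (0 : ℝ≥0∞) < 2⁻¹ by simp))
  refine exists_sqa_section (δ := δ) H R (fun y z hyz => ?_) x h (fun y z hyz => ?_)
    fun w z z' hw hz hz' => ?_
  · exact (hR y z hyz).trans_le ((min_le_left _ _).trans (min_le_right _ _))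
  · exact (hR y z hyz).trans_le (min_le_right _ _)
  · exact hO z ((hR x z hz).trans_le ((min_le_left _ _).trans (min_le_left _ _))) w z' hw hz'

end RegularAtlas

/-! ### Limits of equicontinuous groups of homeomorphisms of a Cantor set -/

section Limits

variable {X : Type u} [TopologicalSpace X]

/-- A separating sequence of open equivalence relations which are invariant under a group. -/
structure InvariantFiltration (G : Subgroup (X ≃ₜ X)) where
  /-- the equivalence relations -/
  rel : ℕ → Setoid X
  eventually_rel : ∀ l y, ∀ᶠ z in 𝓝 y, rel l y z
  invariant : ∀ l, ∀ g ∈ G, ∀ y z, rel l y z → rel l (g y) (g z)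
  antitone : ∀ {l m}, l ≤ m → ∀ {y z}, rel m y z → rel l y z
  separating : ∀ {y z}, (∀ l, rel l y z) → y = z

namespace InvariantFiltration

variable {G : Subgroup (X ≃ₜ X)} (B : InvariantFiltration G)

theorem isClosed_class (l : ℕ) (y : X) : IsClosed {z | B.rel l y z} := by
  rw [← isOpen_compl_iff, isOpen_iff_mem_nhds]
  intro z hz
  filter_upwards [B.eventually_rel l z] with t ht h
  exact hz ((B.rel l).trans h ((B.rel l).symm ht))

variable [CompactSpace X]

/-- The classes of `y` are compact and decrease to `{y}`. -/
theorem exists_class_subset {y : X} {W : Set X} (hW : W ∈ 𝓝 y) :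
    ∃ l, ∀ z, B.rel l y z → z ∈ W := by
  refine exists_subset_nhds_of_isCompact' (V := fun l => {z | B.rel l y z})
    (directed_of_isDirected_le fun l m hlm z hz => B.antitone hlm hz)
    (fun l => (B.isClosed_class l y).isCompact) (fun l => B.isClosed_class l y) ?_
  intro z hz
  rw [← B.separating fun l => mem_iInter.1 hz l]
  exact hW

theorem exists_uniform_class_subset {K W : Set X} (hK : IsCompact K) (hW : IsOpen W)
    (hKW : K ⊆ W) : ∃ l, ∀ y ∈ K, ∀ z, B.rel l y z → z ∈ W := by
  have h1 : ∀ y ∈ K, ∃ l, ∀ z, B.rel l y z → z ∈ W := fun y hy =>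
    B.exists_class_subset (hW.mem_nhds (hKW hy))
  choose! l hl using h1
  obtain ⟨t, htK, ht⟩ := hK.elim_nhds_subcover (fun y => {z | B.rel (l y) y z})
    (fun y _ => B.eventually_rel (l y) y)
  refine ⟨t.sup l, fun y hy z hz => ?_⟩
  obtain ⟨c, hc, hcy⟩ := mem_iUnion₂.1 (ht hy)
  exact hl c (htK c hc) z ((B.rel _).trans hcy (B.antitone (Finset.le_sup hc) hz))

include B in
/-- Ultrafilters in an equicontinuous group of homeomorphisms converge in its Ellis group. -/
theorem exists_limit (u : Ultrafilter (X ≃ₜ X)) (hu : (G : Set (X ≃ₜ X)) ∈ u) :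
    ∃ h ∈ ellisClosure (G : Set (X ≃ₜ X)),
      ∀ z, Filter.Tendsto (fun g : X ≃ₜ X => g z) u (𝓝 (h z)) := by
  have hlim : ∀ F : (X ≃ₜ X) → X, ∃ y, Filter.Tendsto F u (𝓝 y) := by
    intro F
    obtain ⟨y, -, hy⟩ := isCompact_univ.ultrafilter_le_nhds (u.map F) (by simp)
    exact ⟨y, hy⟩
  choose h hh using fun z => hlim (fun g => g z)
  choose h' hh' using fun z => hlim (fun g => g.symm z)
  have hfin : ∀ l, ∃ t : Finset X, ∀ z, ∃ c ∈ t, B.rel l c z := by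
    intro l
    obtain ⟨t, -, ht⟩ := isCompact_univ.elim_nhds_subcover (fun y => {z | B.rel l y z})
      (fun y _ => B.eventually_rel l y)
    exact ⟨t, fun z => by simpa using ht (mem_univ z)⟩
  -- Each level has finitely many classes, all respected by the maps, so pointwise convergence is
  -- uniform at each level. Applied to `g` and to its inverse, this makes the limit a homeomorphism.
  have key : ∀ (F : (X ≃ₜ X) → X → X) (k : X → X),
      (∀ z, Filter.Tendsto (fun g => F g z) u (𝓝 (k z))) →
      (∀ l, ∀ g ∈ G, ∀ y z, B.rel l y z → B.rel l (F g y) (F g z)) →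
      (∀ l y z, B.rel l y z → B.rel l (k y) (k z)) ∧
      ∀ l, ∀ᶠ g in (u : Filter (X ≃ₜ X)), ∀ z, B.rel l (k z) (F g z) := by
    intro F k hk hF
    have h1 : ∀ l y z, B.rel l y z → B.rel l (k y) (k z) := by
      intro l y z hyz
      obtain ⟨g, hg, h2, h3⟩ := (Filter.Eventually.and hu
        (((hk y).eventually (B.eventually_rel l (k y))).and
        ((hk z).eventually (B.eventually_rel l (k z))))).exists
      exact (B.rel l).trans h2 ((B.rel l).trans (hF l g hg y z hyz) ((B.rel l).symm h3))
    refine ⟨h1, fun l => ?_⟩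
    obtain ⟨t, ht⟩ := hfin l
    filter_upwards [hu, (Filter.eventually_all_finset t).2 fun c _ =>
      (hk c).eventually (B.eventually_rel l (k c))] with g hg h2 z
    obtain ⟨c, hc, hcz⟩ := ht z
    exact (B.rel l).trans ((B.rel l).symm (h1 l c z hcz))
      ((B.rel l).trans (h2 c hc) (hF l g hg c z hcz))
  obtain ⟨k1, k2⟩ := key (fun g z => g z) h hh (fun l g hg => B.invariant l g hg)
  obtain ⟨k1', k2'⟩ := key (fun g z => g.symm z) h' hh'
    (fun l g hg => B.invariant l g⁻¹ (inv_mem hg))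
  have hcont : ∀ k : X → X, (∀ l y z, B.rel l y z → B.rel l (k y) (k z)) → Continuous k := by
    intro k hk
    refine continuous_iff_continuousAt.2 fun y W hW => ?_
    obtain ⟨l, hl⟩ := B.exists_class_subset hW
    exact Filter.mem_map.2 ((B.eventually_rel l y).mono fun z hz => hl _ (hk l y z hz))
  let e : X ≃ₜ X :=
    { toFun := h
      invFun := h'
      left_inv := fun z => by
        refine (B.separating fun l => ?_).symm
        obtain ⟨g, hg, h2, h3⟩ := (Filter.Eventually.and hu ((k2 l).and (k2' l))).exists
        have h4 := B.invariant l g⁻¹ (inv_mem hg) _ _ (h2 z)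
        change B.rel l (g.symm (h z)) (g.symm (g z)) at h4
        rw [g.symm_apply_apply] at h4
        exact (B.rel l).symm ((B.rel l).trans (h3 (h z)) h4)
      right_inv := fun z => by
        refine (B.separating fun l => ?_).symm
        obtain ⟨g, hg, h2, h3⟩ := (Filter.Eventually.and hu ((k2 l).and (k2' l))).exists
        have h4 := B.invariant l g hg _ _ (h3 z)
        rw [g.apply_symm_apply] at h4
        exact (B.rel l).symm ((B.rel l).trans (h2 (h' z)) h4)
      continuous_toFun := hcont h k1
      continuous_invFun := hcont h' k1' }
  refine ⟨e, ?_, hh⟩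
  refine mem_closure_of_tendsto (f := fun g : X ≃ₜ X => (g : C(X, X)))
    (b := (u : Filter (X ≃ₜ X))) ?_ ?_
  · rw [ContinuousMap.tendsto_nhds_compactOpen]
    intro K hK W hW hKW
    obtain ⟨l, hl⟩ := B.exists_uniform_class_subset (hK.image (hcont h k1)) hW
      (image_subset_iff.2 hKW)
    filter_upwards [k2 l] with g hg z hz
    exact hl _ (mem_image_of_mem _ hz) _ (hg z)
  · filter_upwards [hu] with g hg using mem_image_of_mem _ hg

end InvariantFiltration

/-- An element of the Ellis group of a restricted action is a pointwise limit of homeomorphisms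
of the whole space. -/
theorem exists_ultrafilter_of_mem_ellisClosure {G : Set (X ≃ₜ X)} {W : Set X} {f : W ≃ₜ W}
    (hf : f ∈ ellisClosure (restrictedAction G W)) :
    ∃ u : Ultrafilter (X ≃ₜ X), G ∈ u ∧
      ∀ y : W, Filter.Tendsto (fun g : X ≃ₜ X => g y) u (𝓝 (f y : X)) := by
  obtain ⟨v, hv, hvf⟩ := mem_closure_iff_ultrafilter.1 hf
  -- Each restricted map is lifted to an element of `G`; the default identity is never seen by `v`.
  have h1 : ∀ F : C(W, W), ∃ g : X ≃ₜ X,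
      F ∈ (fun k : W ≃ₜ W => (k : C(W, W))) '' restrictedAction G W →
        g ∈ G ∧ ∀ y : W, (F y : X) = g y := by
    intro F
    by_cases hF : F ∈ (fun k : W ≃ₜ W => (k : C(W, W))) '' restrictedAction G W
    · obtain ⟨k, ⟨g, hg, -, hgk⟩, rfl⟩ := hF
      exact ⟨g, fun _ => ⟨hg, hgk⟩⟩
    · exact ⟨Homeomorph.refl X, fun h => absurd h hF⟩
  choose τ hτ using h1
  refine ⟨v.map τ, ?_, fun y => ?_⟩
  · rw [Ultrafilter.mem_map]
    filter_upwards [hv] with F hF using (hτ F hF).1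
  · have h2 : Filter.Tendsto (fun F : C(W, W) => (F y : X)) v (𝓝 (f y : X)) :=
      ((continuous_subtype_val.comp (continuous_eval_const (F := C(W, W)) y)).tendsto
        (f : C(W, W))).mono_left hvf
    rw [Ultrafilter.coe_map, Filter.tendsto_map'_iff]
    refine h2.congr' ?_
    filter_upwards [hv] with F hF using (hτ F hF).2 y

end Limits

/-! ### Sections with finite discriminant group -/

namespace TransverseSection

variable {n : ℕ} {M : Type u} [MetricSpace M] {A : RegularAtlas n M} (P : TransverseSection A)

theorem translate_eq {l : ℕ} {g g' : P.V₀ ≃ₜ P.V₀} (hg : g ∈ P.G₀) (hg' : g' ∈ P.G₀) {y : P.V₀}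
    (h : y ∈ g '' P.V l) (h' : y ∈ g' '' P.V l) : g '' P.V l = g' '' P.V l :=
  ((P.isPartition_translates l).2 y).unique ⟨⟨g, hg, rfl⟩, h⟩ ⟨⟨g', hg', rfl⟩, h'⟩

theorem exists_translate (l : ℕ) (y : P.V₀) : ∃ g ∈ P.G₀, y ∈ g '' P.V l := by
  obtain ⟨Q, ⟨⟨g, hg, rfl⟩, hy⟩, -⟩ := (P.isPartition_translates l).2 y
  exact ⟨g, hg, hy⟩

/-- The partitions of a section by the translates of its chain of clopen sets. -/
def filtration : InvariantFiltration P.G₀ where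
  rel l :=
    { r := fun y z => ∃ g ∈ P.G₀, y ∈ g '' P.V l ∧ z ∈ g '' P.V l
      iseqv := ⟨fun y => (P.exists_translate l y).imp fun g h => ⟨h.1, h.2, h.2⟩,
        fun ⟨g, hg, h1, h2⟩ => ⟨g, hg, h2, h1⟩,
        fun ⟨g, hg, h1, h2⟩ ⟨g', hg', h1', h2'⟩ =>
          ⟨g, hg, h1, (P.translate_eq hg hg' h2 h1').symm ▸ h2'⟩⟩ }
  eventually_rel l y := by
    obtain ⟨g, hg, hy⟩ := P.exists_translate l y
    filter_upwards [(g.isOpenMap _ (P.isClopen_V l).isOpen).mem_nhds hy] with z hz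
    exact ⟨g, hg, hy, hz⟩
  invariant := by
    rintro l g hg y z ⟨k, hk, ⟨y', hy', rfl⟩, ⟨z', hz', rfl⟩⟩
    exact ⟨g * k, mul_mem hg hk, ⟨y', hy', rfl⟩, ⟨z', hz', rfl⟩⟩
  antitone := by
    rintro l m hlm y z ⟨g, hg, hy, hz⟩
    exact ⟨g, hg, image_mono (P.antitone_V hlm) hy, image_mono (P.antitone_V hlm) hz⟩
  separating := by
    intro y z h
    apply Subtype.ext
    refine A.eq_of_transDist (le_antisymm ?_ zero_le)
    refine ge_of_tendsto' (ENNReal.tendsto_pow_atTop_nhds_zero_of_lt_one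
      (r := 2⁻¹) (by simp)) fun l => ?_
    obtain ⟨g, hg, hy, hz⟩ := h l
    refine le_trans ?_ (P.diam_translates l g hg).le
    exact le_iSup₂_of_le (y : A.Transversal) (mem_image_of_mem _ hy)
      (le_iSup₂_of_le (z : A.Transversal) (mem_image_of_mem _ hz) le_rfl)

theorem x_mem (l : ℕ) : P.x ∈ P.V l := by
  have : P.x ∈ ⋂ l, P.V l := by rw [P.iInter_V]; rfl
  exact mem_iInter.1 this l

theorem rel_x_iff {l : ℕ} {y : P.V₀} : P.filtration.rel l P.x y ↔ y ∈ P.V l := by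
  have h1 : ∀ y, y ∈ P.V l → y ∈ (1 : P.V₀ ≃ₜ P.V₀) '' P.V l := fun y hy => ⟨y, hy, rfl⟩
  constructor
  · rintro ⟨g, hg, hx, hy⟩
    rw [P.translate_eq hg (one_mem _) hx (h1 _ (P.x_mem l))] at hy
    obtain ⟨z, hz, rfl⟩ := hy
    exact hz
  · exact fun hy => ⟨1, one_mem _, h1 _ (P.x_mem l), h1 _ hy⟩

variable [CompactSpace M]

/-- A section with finite discriminant group has strongly quasi-analytic Ellis groups on small
pieces. -/
theorem exists_isSQAAction_ellisClosure (hD : P.discriminant.Finite) :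
    ∃ l : ℕ, IsSQAAction (ellisClosure (P.actionOn l)) := by
  have : CompactSpace P.V₀ := isCompact_iff_compactSpace.1 P.isClopen_V₀.isClosed.isCompact
  -- Each `d` with trivial germ at `x` is the identity on some `V (m d)`; the maximum of `m` over
  -- the finite discriminant group serves all its elements.
  have h1 : ∀ d : P.V₀ ≃ₜ P.V₀, ∃ l, (∀ᶠ y in 𝓝 P.x, d y = y) → ∀ y ∈ P.V l, d y = y := by
    intro d
    by_cases hd : ∀ᶠ y in 𝓝 P.x, d y = y
    · obtain ⟨l, hl⟩ := P.filtration.exists_class_subset hd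
      exact ⟨l, fun _ y hy => hl y (P.rel_x_iff.2 hy)⟩
    · exact ⟨0, fun h => absurd h hd⟩
  choose m hm using h1
  refine ⟨hD.toFinset.sup m, ?_⟩
  set l := hD.toFinset.sup m with hl
  rintro _ ⟨f, hf, rfl⟩ U hU ⟨u, hu⟩ - hfix y -
  obtain ⟨v, hv, hvf⟩ := exists_ultrafilter_of_mem_ellisClosure hf
  have hU' : Subtype.val '' U ∈ 𝓝 (u : P.V₀) :=
    ((P.isClopen_V l).isOpen.isOpenMap_subtype_val U hU).mem_nhds ⟨u, hu, rfl⟩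
  -- A small translate `g '' P.V k` around `u` fits into `U`. Hence `g` carries `x` into `U`, so
  -- into `V l`, and the partition property gives `g '' P.V l = P.V l`.
  obtain ⟨k, hk⟩ := P.filtration.exists_class_subset hU'
  obtain ⟨g, hg, hgu⟩ := P.exists_translate k u
  have hgx : g P.x ∈ Subtype.val '' U := hk _ ⟨g, hg, hgu, P.x, P.x_mem k, rfl⟩
  obtain ⟨z₀, hz₀, hz₀x⟩ := hgx
  have hgV : g '' P.V l = P.V l := by
    have := P.translate_eq hg (one_mem _) (l := l) (y := g P.x) ⟨P.x, P.x_mem l, rfl⟩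
      ⟨z₀, z₀.2, hz₀x⟩
    rw [this]
    exact image_id _
  have hgm : ∀ z, z ∈ P.V l → g z ∈ P.V l := fun z hz => hgV ▸ mem_image_of_mem g hz
  -- The limit `h` of the conjugated approximations of `f` is defined on the whole section, lies in
  -- its Ellis group, and extends the conjugate of `f` by `g` from `V l`. It fixes a neighbourhood
  -- of `x`, so it belongs to the discriminant group.
  obtain ⟨h, hh, hlim⟩ := P.filtration.exists_limit (v.map fun s => g⁻¹ * s * g) (by
    rw [Ultrafilter.mem_map]
    filter_upwards [hv] with s hs using mul_mem (mul_mem (inv_mem hg) hs) hg)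
  have hhf : ∀ z (hz : z ∈ P.V l), h z = g.symm (f ⟨g z, hgm z hz⟩) := by
    intro z hz
    have h2 := hlim z
    rw [Ultrafilter.coe_map, Filter.tendsto_map'_iff] at h2
    have h3 : Filter.Tendsto (fun s : P.V₀ ≃ₜ P.V₀ => g.symm (s (g z))) v
        (𝓝 (g.symm (f ⟨g z, hgm z hz⟩))) :=
      (g.symm.continuous.tendsto _).comp (hvf ⟨g z, hgm z hz⟩)
    exact tendsto_nhds_unique h2 h3
  have hfix' : ∀ z (hz : z ∈ P.V l), g z ∈ Subtype.val '' U → h z = z := by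
    rintro z hz ⟨z', hz', hzz'⟩
    have e : z' = ⟨g z, hgm z hz⟩ := Subtype.ext hzz'
    have h4 : f z' = z' := hfix z' hz'
    rw [hhf z hz, ← e, h4, hzz', g.symm_apply_apply]
  have hid : ∀ᶠ z in 𝓝 P.x, h z = z := by
    have h5 : Subtype.val '' U ∈ 𝓝 (g P.x) := by
      rw [← hz₀x]
      exact ((P.isClopen_V l).isOpen.isOpenMap_subtype_val U hU).mem_nhds ⟨z₀, hz₀, rfl⟩
    filter_upwards [(P.isClopen_V l).isOpen.mem_nhds (P.x_mem l),
      g.continuous.continuousAt.eventually_mem h5] with z hz hzU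
    exact hfix' z hz hzU
  have hhD : h ∈ P.discriminant := ⟨hh, hid.self_of_nhds⟩
  have hy : g.symm y ∈ P.V l := by
    obtain ⟨z, hz, hzy⟩ : (y : P.V₀) ∈ g '' P.V l := hgV.symm.subset y.2
    rw [← hzy, g.symm_apply_apply]
    exact hz
  have h6 := hm h hid _ (P.antitone_V (Finset.le_sup (hD.mem_toFinset.2 hhD)) hy)
  rw [hhf _ hy] at h6
  have h7 := Subtype.ext (g.symm.injective h6)
  have e : (⟨g (g.symm y), hgm _ hy⟩ : P.V l) = y := Subtype.ext (g.apply_symm_apply _)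
  rw [e] at h7
  simpa using h7

end TransverseSection

theorem subset_ellisClosure {X : Type u} [TopologicalSpace X] (S : Set (X ≃ₜ X)) :
    S ⊆ ellisClosure S := fun _ hg => subset_closure (mem_image_of_mem _ hg)

theorem mainTheorem6 {n : ℕ} {M : Type u} [MetricSpace M] [CompactSpace M] [ConnectedSpace M]
    (A : RegularAtlas n M) (hequi : A.IsEquicontinuous) (hfin : LeavesFinitePiOneType M) :
    (∃ P : TransverseSection A,
      IsSQA (A.pseudoStarGroupOn P.V₀) ∧ IsSQAAction P.action) ∧
    ∀ P : TransverseSection A, P.discriminant.Finite →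
      ∃ ℓ : ℕ, IsSQAAction (P.actionOn ℓ) ∧ IsSQAAction (ellisClosure (P.actionOn ℓ)) := by
  refine ⟨RegularAtlas.exists_sqa_transverseSection hequi hfin, fun P hD => ?_⟩
  obtain ⟨l, hl⟩ := P.exists_isSQAAction_ellisClosure hD
  refine ⟨l, ?_, hl⟩
  rintro _ ⟨g, hg, rfl⟩
  exact hl _ ⟨g, subset_ellisClosure _ hg, rfl⟩
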